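/- Let $a>0$. For $n\ge 1$ let $M^{\infty,a}$ be the $(n+1)\times n$ lower bidiagonal matrix with diagonal $\sqrt n,\sqrt{n-1},\dots,\sqrt1$ and subdiagonal $\sqrt{a+n-1},\sqrt{a+n-2},\dots,\sqrt a$. Let $\Omega_m=\operatorname{diag}(-1,1,-1,1,\dots)$ ($m\times m$), let $F_m$ be the $m\times m$ flip permutation matrix (ones on the antidiagonal), let $\nabla_{n,n+1}$ be the $n\times(n+1)$ matrix with $-1$ on the diagonal and $1$ on the superdiagonal, and let $S_{n,n+1}=-\tfrac12\Omega_n\nabla_{n,n+1}\Omega_{n+1}$. Put $h=\frac1{2n+a+1}$, $x_i=h(a-1+i)$ for $i=1,\dots,2n+1$, and $$M_{\mathrm{hard}}^{\infty,a}=-\sqrt{2/h}\;F_n\Omega_n(M^{\infty,a})^{T}\Omega_{n+1}F_{n+1}.$$ For $c>-1$, the classical Bessel operator with type (ii) boundary conditions is $\mathcal J_c^\infty=-2\sqrt x\frac{d}{dx}+\frac{c}{\sqrt x}$, acting on the differentiable functions $v$ on $(0,1)$ with $v,\mathcal J_c^\infty v\in L^2(0,1)$, $(\mathcal J_c^\infty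 v)(x)\to0$ as $x\to0^+$ and $(\mathcal J_c^\infty v)(x)\to0$ as $x\to1^-$. Its adjoint has action $(\mathcal J_c^\infty)^*=2\sqrt x\frac{d}{dx}+\frac{c+1}{\sqrt x}$. A number $s>0$ is a (positive) singular value if there are a function $v\not\equiv0$ in the domain and a differentiable function $u$ on $(0,1)$ with $\mathcal J_c^\infty v=su$ and $(\mathcal J_c^\infty)^*u=sv$ on $(0,1)$. **Theorem.** (1) Define the $n\times(n+1)$ matrix $E=E_n$ by $$M_{\mathrm{hard}}^{\infty,a}=-2\operatorname{diag}(\sqrt{x_2},\sqrt{x_4},\dots,\sqrt{x_{2n}})\left(\tfrac1{2h}\nabla_{n,n+1}\right)+(a-1)\operatorname{diag}\left(\tfrac1{\sqrt{x_2}},\tfrac1{\sqrt{x_4}},\dots,\tfrac1{\sqrt{x_{2n}}}\right)S_{n,n+1}+E.$$ Then $E$ is upper bidiagonal (it vanishes off the diagonal and superdiagonal), and for every fixed $\varepsilon>0$ the entries in rows $\lceil\varepsilon/h\rceil,\dots,n$ of $E$ are uniformly $O(h)$: there is a constant $C=C(a,\varepsilon)$ such that $|E_{ij}|\le Ch$ for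 all $n$, all $i$ with $\lceil\varepsilon/h\rceil\le i\le n$ and all $j$. (2) The positive singular values of $\mathcal J_{a-1}^\infty$ with type (ii) boundary conditions form a strictly increasing sequence $0<\sigma_1<\sigma_2<\cdots$, each of multiplicity one (the corresponding $v$ is unique up to a scalar), and for every fixed $k\ge1$ the $k$-th least of the $n$ singular values of $M_{\mathrm{hard}}^{\infty,a}$ satisfies $$\sigma_k(M_{\mathrm{hard}}^{\infty,a})\to\sigma_k\qquad(n\to\infty).$$ -/

import Mathlib

open Matrix Set Filter Topology MeasureTheory

noncomputable section

/-! ### Matrices of the finite difference calculus (rows and columns are indexed from `0`) -/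

/-- `∇_{m,n}`: the `m × n` matrix with `-1` on the diagonal and `1` on the superdiagonal. -/
def nablaMat (m n : ℕ) : Matrix (Fin m) (Fin n) ℝ :=
  Matrix.of fun i j =>
    if (j : ℕ) = (i : ℕ) then -1 else if (j : ℕ) = (i : ℕ) + 1 then 1 else 0

/-- `Ω_n`: the diagonal matrix `diag(-1, 1, -1, 1, …)`. -/
def omegaMat (n : ℕ) : Matrix (Fin n) (Fin n) ℝ :=
  Matrix.diagonal fun i => (-1 : ℝ) ^ ((i : ℕ) + 1)

/-- `F_n`: the flip permutation matrix, with ones from top right to bottom left. -/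
def flipMat (n : ℕ) : Matrix (Fin n) (Fin n) ℝ :=
  Matrix.of fun i j => if (i : ℕ) + (j : ℕ) + 1 = n then 1 else 0

/-- `S_{m,n} = -(1/2) Ω_m ∇_{m,n} Ω_n`: the interpolating matrix. -/
def interpMat (m n : ℕ) : Matrix (Fin m) (Fin n) ℝ :=
  (-(1 / 2 : ℝ)) • (omegaMat m * nablaMat m n * omegaMat n)

/-- A rectangular matrix is upper bidiagonal if it vanishes off the diagonal and superdiagonal. -/
def IsUpperBidiagonal {m n : ℕ} (A : Matrix (Fin m) (Fin n) ℝ) : Prop :=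
  ∀ (i : Fin m) (j : Fin n), (j : ℕ) ≠ (i : ℕ) → (j : ℕ) ≠ (i : ℕ) + 1 → A i j = 0

/-- The `k`-th least (`k = 1, 2, …`) of the `min m n` singular values, counted with multiplicity,
of an `m × n` matrix. `LinearMap.singularValues` lists them in decreasing order from index `0`. -/
def kthLeastSingularValue {m n : ℕ} (A : Matrix (Fin m) (Fin n) ℝ) (k : ℕ) : ℝ :=
  (Matrix.toEuclideanLin A).singularValues (min m n - k)

/-! ### The rectangular Laguerre model at zero temperature, scaled at the hard edge -/

/-- `M^{∞,a}`: the `(n+1) × n` lower bidiagonal matrix with diagonal `√n, √(n-1), …, √1` and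
subdiagonal `√(a+n-1), √(a+n-2), …, √a`. -/
def laguerreRect (a : ℝ) (n : ℕ) : Matrix (Fin (n + 1)) (Fin n) ℝ :=
  Matrix.of fun i j =>
    if (i : ℕ) = (j : ℕ) then √((n : ℝ) - (j : ℕ))
    else if (i : ℕ) = (j : ℕ) + 1 then √(a + (n : ℝ) - 1 - (j : ℕ))
    else 0

/-- The mesh size `h = 1 / (2n + a + 1)`. -/
def hardMeshSize (a : ℝ) (n : ℕ) : ℝ := 1 / (2 * (n : ℝ) + a + 1)

/-- The grid points `x_i = h (a - 1 + i)`. -/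
def hardMeshPoint (a : ℝ) (n i : ℕ) : ℝ := hardMeshSize a n * (a - 1 + (i : ℝ))

/-- `M_hard^{∞,a} = -√(2/h) F_n Ω_n (M^{∞,a})ᵀ Ω_{n+1} F_{n+1}`, an `n × (n+1)` matrix. -/
def laguerreRectHard (a : ℝ) (n : ℕ) : Matrix (Fin n) (Fin (n + 1)) ℝ :=
  (-√(2 / hardMeshSize a n)) •
    (flipMat n * omegaMat n * (laguerreRect a n)ᵀ * omegaMat (n + 1) * flipMat (n + 1))

/-- The finite difference discretization
`-2 diag(√x₂, √x₄, …, √x₂ₙ) ((1/2h) ∇_{n,n+1}) + (a-1) diag(1/√x₂, …, 1/√x₂ₙ) S_{n,n+1}`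
of `-2 √x d/dx + (a-1)/√x`, with codomain mesh `x₂, x₄, …, x₂ₙ` and
domain mesh `x₁, x₃, …, x₂ₙ₊₁`. -/
def besselDiscretization (a : ℝ) (n : ℕ) : Matrix (Fin n) (Fin (n + 1)) ℝ :=
  (-2 : ℝ) • (Matrix.diagonal (fun i : Fin n => √(hardMeshPoint a n (2 * ((i : ℕ) + 1)))) *
      ((1 / (2 * hardMeshSize a n)) • nablaMat n (n + 1))) +
  (a - 1) • (Matrix.diagonal (fun i : Fin n => 1 / √(hardMeshPoint a n (2 * ((i : ℕ) + 1)))) *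
      interpMat n (n + 1))

/-! ### The classical Bessel operator on `(0,1)` with type (ii) boundary conditions -/

/-- The action `-2 √x d/dx + c/√x` of the classical Bessel operator `J_c`. -/
def besselAction (c : ℝ) (v : ℝ → ℝ) (x : ℝ) : ℝ :=
  -2 * √x * deriv v x + c / √x * v x

/-- The action `2 √x d/dx + (c+1)/√x` of the adjoint `J_c*`. -/
def besselAdjointAction (c : ℝ) (u : ℝ → ℝ) (x : ℝ) : ℝ :=
  2 * √x * deriv u x + (c + 1) / √x * u x

/-- Lagrange's identity: the two actions are adjoint to each other up to boundary terms. -/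
theorem besselAction_lagrange (c : ℝ) (v u : ℝ → ℝ) (x : ℝ) (hx : 0 < x)
    (hv : DifferentiableAt ℝ v x) (hu : DifferentiableAt ℝ u x) :
    HasDerivAt (fun t => -2 * √t * (v t * u t))
      (besselAction c v x * u x - v x * besselAdjointAction c u x) x := by
  have h1 : HasDerivAt (fun t : ℝ => √t) (1 / (2 * √x)) x := Real.hasDerivAt_sqrt hx.ne'
  have h2 := (h1.const_mul (-2 : ℝ)).mul (hv.hasDerivAt.mul hu.hasDerivAt)
  refine h2.congr_deriv ?_
  have h3 : √x ≠ 0 := (Real.sqrt_pos.mpr hx).ne'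
  simp only [besselAction, besselAdjointAction, Pi.mul_apply]
  field_simp
  ring

/-- The domain of `J_c` with type (ii) boundary conditions: `v` and `J_c v` are square integrable
on `(0,1)`, `v` is differentiable there, `(J_c v)(0) = 0` and `(J_c v)(1) = 0`. -/
structure MemBesselDomainII (c : ℝ) (v : ℝ → ℝ) : Prop where
  differentiable : ∀ x ∈ Ioo (0 : ℝ) 1, DifferentiableAt ℝ v x
  memLp : MemLp v 2 (volume.restrict (Ioo (0 : ℝ) 1))
  memLp_action : MemLp (besselAction c v) 2 (volume.restrict (Ioo (0 : ℝ) 1))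
  boundary_zero : Tendsto (besselAction c v) (𝓝[>] 0) (𝓝 0)
  boundary_one : Tendsto (besselAction c v) (𝓝[<] 1) (𝓝 0)

/-- `v` and `u` are right and left singular functions, for the positive singular value `s`, of `J_c`
with type (ii) boundary conditions: `J_c v = s u` and `J_c* u = s v` on `(0,1)`.
The left singular function `u` vanishes at `0` and `1`, because `J_c v` does. -/
structure IsBesselSingularTripleII (c s : ℝ) (v u : ℝ → ℝ) : Prop where
  pos : 0 < s
  mem_domain : MemBesselDomainII c v
  nonzero : ∃ x ∈ Ioo (0 : ℝ) 1, v x ≠ 0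
  differentiable : ∀ x ∈ Ioo (0 : ℝ) 1, DifferentiableAt ℝ u x
  action : ∀ x ∈ Ioo (0 : ℝ) 1, besselAction c v x = s * u x
  adjoint_action : ∀ x ∈ Ioo (0 : ℝ) 1, besselAdjointAction c u x = s * v x

/-- The set of positive singular values of `J_c` with type (ii) boundary conditions. -/
def besselSingularValuesII (c : ℝ) : Set ℝ :=
  {s | ∃ v u : ℝ → ℝ, IsBesselSingularTripleII c s v u}

/-- `σ 0, σ 1, …` are the first, second, … least positive singular values of `J_c` with type (ii)
boundary conditions: `σ` lists them all in increasing order, and each has multiplicity one. -/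
structure ListsBesselSingularValuesII (c : ℝ) (σ : ℕ → ℝ) : Prop where
  strictMono : StrictMono σ
  range_eq : Set.range σ = besselSingularValuesII c
  simple : ∀ (s : ℝ) (v u v' u' : ℝ → ℝ), IsBesselSingularTripleII c s v u →
    IsBesselSingularTripleII c s v' u' → ∃ r : ℝ, ∀ x ∈ Ioo (0 : ℝ) 1, v' x = r * v x

end

/-!
The matrix `M = M_hard` is upper bidiagonal, with diagonal `√(2/h) √(a + i)` and superdiagonal
`-√(2/h) √(i + 1)`, `i = 0, …, n - 1` (`laguerreRectHard_apply`). At the mesh point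
`x = h (a + 1 + 2 i)` these are `√(x + h (a - 1)) / h` and `-√(x - h (a - 1)) / h`, and the
discretization consists of their first-order Taylor expansions at `x`. Hence the error is of order
`h` away from `x = 0` (`abs_laguerreRectHard_sub_besselDiscretization_le`).

For the singular values both problems are solved explicitly. On the continuous side let
`Q(t) = ∑ (-t)ᵏ / (k! (a + 1)ₖ)`, the entire part of the Bessel function `J_a`. The boundary
condition at `0` and square integrability leave only the singular functions `u = J_a(s √x)` and
`v = J_{a-1}(s √x)`, by a Wronskian argument, and the boundary condition at `1` then says that
`Q(s² / 4) = 0`. So the singular values are the numbers `2 √t`, where `t` runs through the positive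
zeros of `Q` (`listsBesselSingularValuesII`). These zeros are simple because of an energy estimate
(`besselEnergy_pos`), and unbounded because of a Riccati equation (`exists_besselQ_eq_zero`).

On the discrete side the eigenvectors of `Mᵀ M` consist of Laguerre polynomials: the eigenvalue
equation is the pair of relations between the polynomials with parameters `a - 1` and `a`, and its
last row says that `λ = s²` is an eigenvalue exactly when `μ L_n^{(a)}(μ) = 0` for `μ = h λ / 2`
(`transpose_mulVec_mulVec_laguerreVec`, `eq_laguerreVec_of_transpose_mulVec_mulVec`). All
eigenvalues are simple, since the recurrence determines an eigenvector by its first component.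

With `s² = 4 t` the discrete and the continuous singular values are thus given by the zeros of
`t L_n^{(a)}(2 h t)` and of `t Q(t)`. The normalized Laguerre polynomials converge to `Q` by
dominated convergence of their coefficients, locally uniformly together with their derivatives, so
that the `k`-th zeros converge (`tendsto_zeros`). The factor `t` adds the zero `0` to both lists and
accounts for the kernel of `M`; it also starts the induction on `k`.
-/

noncomputable section

/-! ### Entire series with factorially bounded coefficients -/

/-- The sum of the real power series with coefficients `c`. -/
def powSum (c : ℕ → ℝ) (t : ℝ) : ℝ := ∑' k, c k * t ^ k

/-- The coefficients of the derivative of the power series with coefficients `c`. -/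
def derivCoeff (c : ℕ → ℝ) (k : ℕ) : ℝ := (k + 1) * c (k + 1)

lemma summable_powSum {c : ℕ → ℝ} {M : ℝ} (hc : ∀ k, |c k| ≤ M / k.factorial) (t : ℝ) :
    Summable fun k => c k * t ^ k := by
  refine Summable.of_norm_bounded ((Real.summable_pow_div_factorial |t|).mul_left M) fun k => ?_
  rw [Real.norm_eq_abs, abs_mul, abs_pow, mul_div_assoc', mul_comm M, mul_div_assoc, mul_comm]
  exact mul_le_mul_of_nonneg_left (hc k) (by positivity)

/-- The bound `M / k!` on the coefficients passes to the derived series. -/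
lemma abs_derivCoeff_le {c : ℕ → ℝ} {M : ℝ} (hc : ∀ k, |c k| ≤ M / k.factorial) (k : ℕ) :
    |derivCoeff c k| ≤ M / k.factorial := by
  have h := hc (k + 1)
  have hk : (0 : ℝ) < k + 1 := by positivity
  rw [derivCoeff, abs_mul, abs_of_pos hk]
  rw [Nat.factorial_succ, Nat.cast_mul, Nat.cast_succ, mul_comm, ← div_div, le_div_iff₀ hk] at h
  linarith

lemma hasDerivAt_powSum {c : ℕ → ℝ} {M : ℝ} (hc : ∀ k, |c k| ≤ M / k.factorial) (t : ℝ) :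
    HasDerivAt (powSum c) (powSum (derivCoeff c) t) t := by
  have hM : 0 ≤ M := by simpa using (abs_nonneg _).trans (hc 0)
  have key : ∀ k y, c (k + 1) * (((k + 1 : ℕ) : ℝ) * y ^ (k + 1 - 1)) = derivCoeff c k * y ^ k := by
    intro k y
    simp only [derivCoeff, Nat.cast_succ, Nat.add_sub_cancel]
    ring
  have hu : Summable fun k : ℕ => |c k| * (k * (|t| + 1) ^ (k - 1)) := by
    rw [← summable_nat_add_iff 1]
    refine (summable_powSum (c := fun k => |derivCoeff c k|) (M := M) (fun k => ?_)
      (|t| + 1)).congr fun k => ?_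
    · rw [abs_abs]; exact abs_derivCoeff_le hc k
    · simp only [derivCoeff, Nat.cast_succ, Nat.add_sub_cancel, abs_mul]
      rw [abs_of_nonneg (by positivity : (0 : ℝ) ≤ k + 1)]
      ring
  have h := hasDerivAt_tsum_of_isPreconnected hu Metric.isOpen_ball
    (convex_ball (0 : ℝ) (|t| + 1)).isPreconnected
    (g := fun k y => c k * y ^ k) (g' := fun k y => c k * (k * y ^ (k - 1)))
    (fun k y _ => (hasDerivAt_pow k y).const_mul (c k)) (fun k y hy => by
      rw [Real.norm_eq_abs, abs_mul, abs_mul, abs_pow, Nat.abs_cast]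
      have : |y| ≤ |t| + 1 := by simpa using (Metric.mem_ball.1 hy).le
      gcongr)
    (Metric.mem_ball_self (by positivity)) (summable_powSum hc 0)
    (y := t) (by simp [Metric.mem_ball])
  refine h.congr_deriv ?_
  rw [Summable.tsum_eq_zero_add]
  · simp [powSum, ← key]
  · rw [← summable_nat_add_iff 1]
    exact (summable_powSum (abs_derivCoeff_le hc) t).congr fun k => (key k t).symm

/-- Dominated convergence for series with factorially bounded coefficients, jointly in the index
and in the argument. -/
lemma tendsto_powSum {C : ℕ → ℕ → ℝ} {c : ℕ → ℝ} {M : ℝ} (hC : ∀ n k, |C n k| ≤ M / k.factorial)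
    (hlim : ∀ k, Tendsto (C · k) atTop (𝓝 (c k))) (t : ℝ) :
    Tendsto (fun p : ℕ × ℝ => powSum (C p.1) p.2) (atTop ×ˢ 𝓝 t) (𝓝 (powSum c t)) := by
  have hM : 0 ≤ M := by simpa using (abs_nonneg _).trans (hC 0 0)
  refine tendsto_tsum_of_dominated_convergence
    ((Real.summable_pow_div_factorial (|t| + 1)).mul_left M)
    (fun k => ((hlim k).comp tendsto_fst).mul (tendsto_snd.pow k)) ?_
  have h1 : ∀ᶠ y in 𝓝 t, |y| < |t| + 1 :=
    (continuous_abs.tendsto t).eventually_lt_const (by linarith)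
  filter_upwards [h1.prod_inr (atTop : Filter ℕ)] with p hp k
  rw [Real.norm_eq_abs, abs_mul, abs_pow, mul_div_assoc', mul_comm M, mul_div_assoc, mul_comm]
  gcongr
  exact hC _ _

lemma tendsto_derivCoeff {C : ℕ → ℕ → ℝ} {c : ℕ → ℝ}
    (hlim : ∀ k, Tendsto (C · k) atTop (𝓝 (c k))) (k : ℕ) :
    Tendsto (fun n => derivCoeff (C n) k) atTop (𝓝 (derivCoeff c k)) :=
  (hlim (k + 1)).const_mul _

/-! ### Convergence of simple zeros -/

lemma exists_sign_change_of_simple_zero {f : ℝ → ℝ} {d x l r : ℝ} (hf : HasDerivAt f d x)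
    (hd : d ≠ 0) (hx : f x = 0) (hl : l < x) (hr : x < r) :
    ∃ y ∈ Ioo l x, ∃ z ∈ Ioo x r, f y * f z < 0 := by
  have h1 : ∀ᶠ y in 𝓝[≠] x, 0 < slope f x y * d :=
    ((hasDerivAt_iff_tendsto_slope.1 hf).mul_const d).eventually_const_lt (mul_self_pos.2 hd)
  have hv : ∀ y, y ≠ x → f y = slope f x y * (y - x) := by
    intro y hy
    have := sub_ne_zero.2 hy
    rw [slope_def_field, hx]
    field_simp
    ring
  have h2 := (h1.filter_mono (nhdsWithin_mono x (s := Iio x) fun y hy => ne_of_lt hy)).and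
    (Ioo_mem_nhdsLT hl)
  have h3 := (h1.filter_mono (nhdsWithin_mono x (s := Ioi x) fun y hy => ne_of_gt hy)).and
    (Ioo_mem_nhdsGT hr)
  obtain ⟨y, hy, hy'⟩ := h2.exists
  obtain ⟨z, hz, hz'⟩ := h3.exists
  refine ⟨y, hy', z, hz', ?_⟩
  rw [hv y hy'.2.ne, hv z hz'.1.ne']
  have hs : 0 < slope f x y * slope f x z := by
    have := mul_pos hy hz
    have h4 : 0 < d * d := mul_self_pos.2 hd
    refine pos_of_mul_pos_left (b := d * d) ?_ h4.le
    linarith [this, mul_comm d d,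
      (by ring : slope f x y * slope f x z * (d * d) = slope f x y * d * (slope f x z * d))]
  have h5 : (y - x) * (z - x) < 0 := mul_neg_of_neg_of_pos (by linarith [hy'.2]) (by linarith [hz'.1])
  have := mul_neg_of_pos_of_neg hs h5
  linarith [(by ring : slope f x y * slope f x z * ((y - x) * (z - x)) =
    slope f x y * (y - x) * (slope f x z * (z - x)))]

/-- If `F n → f` and `F' n → f'` locally uniformly and the zeros `τ 0 < τ 1 < ⋯` of `f` on
`[τ 0, ∞)` are simple, then the `k`-th zero of `F n` on `[τ 0, ∞)` converges to `τ k`, provided that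
`τ 0` is a zero of every `F n`. By induction on `k`: close to `τ k` the function `F n` is strictly
monotone, so it has no second zero there; between `τ k` and `τ (k + 1)` it does not vanish; and
close to `τ (k + 1)` it changes sign. -/
theorem tendsto_zeros {f f' : ℝ → ℝ} {F F' : ℕ → ℝ → ℝ} {τ : ℕ → ℝ} {b : ℕ → ℕ → ℝ}
    (hf : ∀ t, HasDerivAt f (f' t) t) (hF : ∀ n t, HasDerivAt (F n) (F' n t) t)
    (hlim : ∀ t, Tendsto (fun p : ℕ × ℝ => F p.1 p.2) (atTop ×ˢ 𝓝 t) (𝓝 (f t)))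
    (hlim' : ∀ t, Tendsto (fun p : ℕ × ℝ => F' p.1 p.2) (atTop ×ˢ 𝓝 t) (𝓝 (f' t)))
    (hτ : StrictMono τ) (hzero : ∀ t, τ 0 ≤ t → (f t = 0 ↔ ∃ k, τ k = t))
    (hsimple : ∀ k, f' (τ k) ≠ 0) (hb0 : ∀ n, b n 0 = τ 0)
    (hb : ∀ n k, k ≤ n → F n (b n k) = 0) (hlt : ∀ n k, k < n → b n k < b n (k + 1))
    (hleast : ∀ n k z, k < n → b n k < z → F n z = 0 → b n (k + 1) ≤ z) (k : ℕ) :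
    Tendsto (b · k) atTop (𝓝 (τ k)) := by
  have hτ0 : ∀ k, τ 0 ≤ τ k := fun k => hτ.monotone (Nat.zero_le k)
  induction k with
  | zero => simpa only [hb0] using tendsto_const_nhds
  | succ k ih =>
    have hkk : τ k < τ (k + 1) := hτ k.lt_succ_self
    refine tendsto_order.2 ⟨fun x hx => ?_, fun x hx => ?_⟩
    · -- `F n` is strictly monotone near `τ k`
      obtain ⟨N, hN, U, hU, hNU⟩ := eventually_prod_iff.1
        ((hlim' (τ k)).eventually_ne (hsimple k))
      obtain ⟨δ, hδ, hball⟩ := Metric.eventually_nhds_iff_ball.1 hU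
      -- `F n` does not vanish on the rest of the gap below `x`
      have hgap : ∀ᶠ n in atTop, ∀ y ∈ Icc (τ k + δ) x, F n y ≠ 0 := by
        refine isCompact_Icc.induction_on (p := fun K => ∀ᶠ n in atTop, ∀ y ∈ K, F n y ≠ 0)
          (by simp) (fun s t hst h => h.mono fun n hn y hy => hn y (hst hy))
          (fun s t hs ht => (hs.and ht).mono fun n hn y hy => hy.elim (hn.1 y) (hn.2 y)) ?_
        intro y hy
        have hfy : f y ≠ 0 := by
          intro h0
          obtain ⟨j, rfl⟩ := (hzero y (by linarith [hτ0 k, hy.1])).1 h0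
          have h1 : k < j := hτ.lt_iff_lt.1 (by linarith [hy.1])
          have h2 : j < k + 1 := hτ.lt_iff_lt.1 (by linarith [hy.2])
          omega
        obtain ⟨N', hN', U', hU', h'⟩ := eventually_prod_iff.1 ((hlim y).eventually_ne hfy)
        exact ⟨_, mem_nhdsWithin_of_mem_nhds hU', hN'.mono fun n hn z hz => h' hn hz⟩
      filter_upwards [hN, hgap, eventually_gt_atTop k, ih (Metric.ball_mem_nhds _ hδ)]
        with n h1 h2 h3 h4
      by_contra! hle
      have h5 := hlt n k h3
      rcases lt_or_ge (b n (k + 1)) (τ k + δ) with h6 | h6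
      · obtain ⟨ξ, hξ, hξ'⟩ := exists_hasDerivAt_eq_zero h5
          (fun y _ => (hF n y).continuousAt.continuousWithinAt)
          (by rw [hb n k h3.le, hb n (k + 1) h3]) (fun y _ => hF n y)
        refine hNU h1 (hball ξ ?_) hξ'
        rw [Real.ball_eq_Ioo]
        rw [mem_preimage, Real.ball_eq_Ioo] at h4
        exact ⟨h4.1.trans hξ.1, hξ.2.trans h6⟩
      · exact h2 _ ⟨h6, hle⟩ (hb n (k + 1) h3)
    · obtain ⟨l, hl, r, hr, hlr⟩ := exists_sign_change_of_simple_zero (hf (τ (k + 1)))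
        (hsimple (k + 1)) ((hzero _ (hτ0 _)).2 ⟨_, rfl⟩) hkk hx
      have hpt : ∀ t, Tendsto (fun n => F n t) atTop (𝓝 (f t)) := fun t =>
        (hlim t).comp (tendsto_id.prodMk tendsto_const_nhds)
      filter_upwards [((hpt l).mul (hpt r)).eventually_lt_const hlr, eventually_gt_atTop k,
        ih.eventually_lt_const hl.1] with n h1 h2 h3
      have hcont : ContinuousOn (F n) (Icc l r) :=
        fun y _ => (hF n y).continuousAt.continuousWithinAt
      have hlr' : l ≤ r := (hl.2.trans hr.1).le
      obtain ⟨z, hz, hz0⟩ : ∃ z ∈ Icc l r, F n z = 0 := by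
        rcases mul_neg_iff.1 h1 with ⟨hp, hn⟩ | ⟨hn, hp⟩
        · exact intermediate_value_Icc' hlr' hcont ⟨hn.le, hp.le⟩
        · exact intermediate_value_Icc hlr' hcont ⟨hn.le, hp.le⟩
      exact (hleast n k z h2 (h3.trans_le hz.1) hz0).trans_lt (hz.2.trans_lt hr.2)

/-- A set of reals that is unbounded above and has finitely many elements below each bound is
listed by a strictly increasing sequence. -/
theorem exists_strictMono_range_eq {S : Set ℝ} (hfin : ∀ T, (S ∩ Iic T).Finite)
    (hub : ∀ T, ∃ x ∈ S, T < x) : ∃ τ : ℕ → ℝ, StrictMono τ ∧ Set.range τ = S := by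
  classical
  have hnext : ∀ T, ∃ x, IsLeast (S ∩ Ioi T) x := by
    intro T
    obtain ⟨x, hx, hTx⟩ := hub T
    have hne : (S ∩ Ioc T x).Nonempty := ⟨x, hx, hTx, le_rfl⟩
    have hf : (S ∩ Ioc T x).Finite := (hfin x).subset fun y hy => ⟨hy.1, hy.2.2⟩
    obtain ⟨m, hm, hmin⟩ := Set.exists_min_image _ id hf hne
    refine ⟨m, ⟨hm.1, hm.2.1⟩, fun y hy => ?_⟩
    rcases le_or_gt y x with h | h
    · exact hmin y ⟨hy.1, hy.2, h⟩
    · exact hm.2.2.trans h.le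
  choose next hnext using hnext
  obtain ⟨B, hB⟩ : ∃ B, ∀ x ∈ S, B < x := by
    obtain ⟨l, hl⟩ := (hfin 0).bddBelow
    refine ⟨min l 0 - 1, fun x hx => ?_⟩
    rcases le_or_gt x 0 with h | h
    · linarith [hl ⟨hx, h⟩, min_le_left l 0]
    · linarith [min_le_right l 0]
  let τ : ℕ → ℝ := fun k => next^[k] (next B)
  have hsucc : ∀ k, τ (k + 1) = next (τ k) := fun k => Function.iterate_succ_apply' _ _ _
  have hmem : ∀ k, τ k ∈ S := by
    intro k
    cases k with
    | zero => exact (hnext B).1.1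
    | succ k => rw [hsucc]; exact (hnext _).1.1
  have hmono : StrictMono τ := strictMono_nat_of_lt_succ fun k => by
    rw [hsucc]; exact (hnext _).1.2
  refine ⟨τ, hmono, Subset.antisymm (range_subset_iff.2 hmem) fun x hx => ?_⟩
  -- an element that is never listed bounds the whole sequence
  by_contra hnot
  have hlt : ∀ k, τ k < x := by
    intro k
    induction k with
    | zero => exact ((hnext B).2 ⟨hx, hB x hx⟩).lt_of_ne fun h => hnot ⟨0, h⟩
    | succ k ih =>
      refine lt_of_le_of_ne ?_ fun h => hnot ⟨k + 1, h⟩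
      rw [hsucc]
      exact (hnext _).2 ⟨hx, ih⟩
  exact Set.infinite_range_of_injective hmono.injective
    ((hfin x).subset (range_subset_iff.2 fun k => ⟨hmem k, (hlt k).le⟩))

/-! ### The entire part of the Bessel function and its zeros -/

lemma hasSum_mul_powSum_derivCoeff {c : ℕ → ℝ} {M : ℝ} (hc : ∀ k, |c k| ≤ M / k.factorial)
    (t : ℝ) : HasSum (fun k : ℕ => k * c k * t ^ k) (t * powSum (derivCoeff c) t) := by
  rw [← hasSum_nat_add_iff' 1]
  simp only [Finset.range_one, Finset.sum_singleton, Nat.cast_zero, zero_mul, sub_zero]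
  refine ((summable_powSum (abs_derivCoeff_le hc) t).hasSum.mul_left t).congr_fun ?_
  intro k
  simp only [derivCoeff, Nat.cast_succ]
  ring

/-- The rising factorial `(a + 1) (a + 2) ⋯ (a + k)`. -/
def risingSucc (a : ℝ) (k : ℕ) : ℝ := ∏ i ∈ Finset.range k, (a + 1 + i)

lemma risingSucc_succ (a : ℝ) (k : ℕ) : risingSucc a (k + 1) = risingSucc a k * (a + 1 + k) :=
  Finset.prod_range_succ _ _

lemma one_le_risingSucc {a : ℝ} (ha : 0 < a) (k : ℕ) : 1 ≤ risingSucc a k := by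
  induction k with
  | zero => simp [risingSucc]
  | succ k ih =>
    rw [risingSucc_succ]
    exact one_le_mul_of_one_le_of_one_le ih (by linarith [k.cast_nonneg (α := ℝ)])

/-- The coefficients of `∑ (-t)ᵏ / (k! (a + 1)ₖ)`. -/
def besselCoeff (a : ℝ) (k : ℕ) : ℝ := (-1) ^ k / (k.factorial * risingSucc a k)

lemma abs_besselCoeff_le {a : ℝ} (ha : 0 < a) (k : ℕ) : |besselCoeff a k| ≤ 1 / k.factorial := by
  have h := one_le_risingSucc ha k
  have hk : (0 : ℝ) < k.factorial := by positivity
  rw [besselCoeff, abs_div, abs_pow, abs_neg, abs_one, one_pow, abs_of_pos (by positivity)]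
  gcongr
  exact le_mul_of_one_le_right hk.le h

lemma besselCoeff_succ {a : ℝ} (ha : 0 < a) (k : ℕ) :
    (k + 1) * (a + 1 + k) * besselCoeff a (k + 1) = -besselCoeff a k := by
  have h := (zero_lt_one.trans_le (one_le_risingSucc ha k)).ne'
  have hk : (k.factorial : ℝ) ≠ 0 := by positivity
  have h2 : a + 1 + k ≠ 0 := by positivity
  rw [besselCoeff, besselCoeff, risingSucc_succ, Nat.factorial_succ]
  push_cast
  field_simp
  ring

/-- `∑ (-t)ᵏ / (k! (a + 1)ₖ)`: the Bessel function `J_a(r)` is a multiple of `rᵃ` times the value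
of this function at `r² / 4`. -/
def besselQ (a t : ℝ) : ℝ := powSum (besselCoeff a) t

/-- The derivative of `besselQ a`. -/
def besselQ' (a t : ℝ) : ℝ := powSum (derivCoeff (besselCoeff a)) t

/-- `a Q(t) + t Q'(t)`: the Bessel function `J_{a-1}(r)` is a multiple of `r ^ (a - 1)` times the
value of this function at `r² / 4`. -/
def besselP (a t : ℝ) : ℝ := a * besselQ a t + t * besselQ' a t

variable {a : ℝ}

lemma hasDerivAt_besselQ (ha : 0 < a) (t : ℝ) : HasDerivAt (besselQ a) (besselQ' a t) t :=
  hasDerivAt_powSum (abs_besselCoeff_le ha) t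

lemma mul_besselQ' (a t : ℝ) : t * besselQ' a t = besselP a t - a * besselQ a t := by
  rw [besselP]; ring

lemma besselQ_zero (a : ℝ) : besselQ a 0 = 1 := by
  rw [besselQ, powSum, tsum_eq_single 0 (fun k hk => by simp [hk])]
  simp [besselCoeff, risingSucc]

lemma besselP_zero (a : ℝ) : besselP a 0 = a := by simp [besselP, besselQ_zero]

/-- This is Bessel's equation `t Q'' + (a + 1) Q' + Q = 0`. -/
lemma hasDerivAt_besselP (ha : 0 < a) (t : ℝ) : HasDerivAt (besselP a) (-besselQ a t) t := by
  have hc := abs_besselCoeff_le ha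
  have hQ' : HasDerivAt (besselQ' a) _ t := hasDerivAt_powSum (abs_derivCoeff_le hc) t
  refine (((hasDerivAt_besselQ ha t).const_mul a).add ((hasDerivAt_id t).mul hQ')).congr_deriv ?_
  have h1 := hasSum_mul_powSum_derivCoeff (abs_derivCoeff_le hc) t
  have h2 := (summable_powSum (abs_derivCoeff_le hc) t).hasSum.mul_left (a + 1)
  have h3 := (h1.add h2).unique (((summable_powSum hc t).hasSum.neg).congr_fun fun k => ?_)
  · change _ = -powSum (besselCoeff a) t at h3
    change a * powSum (derivCoeff (besselCoeff a)) t +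
      (1 * powSum (derivCoeff (besselCoeff a)) t + t * _) = -powSum (besselCoeff a) t
    rw [← h3]
    simp only [powSum]
    ring
  · have := besselCoeff_succ ha k
    simp only [derivCoeff]
    linear_combination t ^ k * this

lemma continuous_besselQ (ha : 0 < a) : Continuous (besselQ a) :=
  continuous_iff_continuousAt.2 fun t => (hasDerivAt_besselQ ha t).continuousAt

lemma continuous_besselP (ha : 0 < a) : Continuous (besselP a) :=
  continuous_iff_continuousAt.2 fun t => (hasDerivAt_besselP ha t).continuousAt

/-- `P` and `Q` have no common zero: the energy `P² + t Q²` has derivative `(1 - 2a) Q²`, so that it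
becomes monotone when multiplied by a high power of `t`. -/
lemma besselEnergy_pos (ha : 0 < a) {t : ℝ} (ht : 0 ≤ t) :
    0 < besselP a t ^ 2 + t * besselQ a t ^ 2 := by
  set E : ℝ → ℝ := fun t => besselP a t ^ 2 + t * besselQ a t ^ 2 with hE
  have hE0 : ∀ s, 0 ≤ s → 0 ≤ E s := fun s hs => by simp only [hE]; positivity
  have hcont : Continuous E := by
    have := continuous_besselP ha
    have := continuous_besselQ ha
    fun_prop
  obtain ⟨m, hm⟩ := exists_nat_ge (2 * a)
  have hderiv : ∀ s, HasDerivAt (fun s => s ^ (m + 1) * E s)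
      (s ^ m * ((m + 1) * besselP a s ^ 2 + (m + 2 - 2 * a) * s * besselQ a s ^ 2)) s := by
    intro s
    have h1 := ((hasDerivAt_besselP ha s).pow 2).add
      ((hasDerivAt_id s).mul ((hasDerivAt_besselQ ha s).pow 2))
    refine ((hasDerivAt_pow (m + 1) s).mul h1).congr_deriv ?_
    have h2 := mul_besselQ' a s
    simp only [Pi.add_apply, Pi.mul_apply, Pi.pow_apply, id, Nat.add_sub_cancel]
    push_cast
    linear_combination (2 * s ^ (m + 1) * besselQ a s) * h2
  have hmono : MonotoneOn (fun s => s ^ (m + 1) * E s) (Ici 0) := by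
    refine monotoneOn_of_hasDerivWithinAt_nonneg (convex_Ici 0)
      (fun s _ => (hderiv s).continuousAt.continuousWithinAt)
      (fun s _ => (hderiv s).hasDerivWithinAt) fun s hs => ?_
    rw [interior_Ici, mem_Ioi] at hs
    have : (0 : ℝ) ≤ m + 2 - 2 * a := by linarith
    positivity
  have hEa : 0 < E 0 := by simp only [hE, besselP_zero]; positivity
  refine (hE0 t ht).lt_of_ne' fun h0 => ?_
  rcases ht.eq_or_lt with rfl | ht
  · exact hEa.ne' h0
  · obtain ⟨s, hs, hs'⟩ := (((hcont.tendsto 0).eventually_const_lt hEa).filter_mono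
      nhdsWithin_le_nhds |>.and (Ioo_mem_nhdsGT ht)).exists
    have := hmono (mem_Ici.2 hs'.1.le) (mem_Ici.2 ht.le) hs'.2.le
    change s ^ (m + 1) * E s ≤ t ^ (m + 1) * E t at this
    rw [show E t = 0 from h0, mul_zero] at this
    have : 0 < s ^ (m + 1) * E s := mul_pos (pow_pos hs'.1 _) hs
    linarith

/-- The zeros of `Q` have no upper bound: where `Q` does not vanish, `ρ(r) = 2 P / (r Q)` at
`t = r² / 4` satisfies the Riccati equation `ρ' = -1 - ρ² + (2a - 1) ρ / r`, so that `arctan ρ`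
decreases at rate at least `1/2` for large `r`, and this cannot last. -/
lemma exists_besselQ_eq_zero (ha : 0 < a) (T : ℝ) : ∃ t, T < t ∧ besselQ a t = 0 := by
  by_contra! hne
  set R : ℝ := |2 * a - 1| + |T| + 5 with hR
  have hR1 : |2 * a - 1| ≤ R := by rw [hR]; linarith [abs_nonneg T]
  have hR0 : 5 ≤ R := by rw [hR]; linarith [abs_nonneg T, abs_nonneg (2 * a - 1)]
  have hRT : |T| ≤ R := by rw [hR]; linarith [abs_nonneg (2 * a - 1)]
  have hQ : ∀ r, R ≤ r → besselQ a (r ^ 2 / 4) ≠ 0 := fun r hr =>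
    hne _ (by nlinarith [le_abs_self T])
  set ρ : ℝ → ℝ := fun r => 2 * besselP a (r ^ 2 / 4) / (r * besselQ a (r ^ 2 / 4)) with hρ
  have hderiv : ∀ r, R ≤ r → HasDerivAt ρ (-1 - ρ r ^ 2 + (2 * a - 1) * ρ r / r) r := by
    intro r hr
    have hr0 : r ≠ 0 := by linarith
    have hQr := hQ r hr
    have ht : HasDerivAt (fun r : ℝ => r ^ 2 / 4) (r / 2) r := by
      refine ((hasDerivAt_pow 2 r).div_const 4).congr_deriv ?_
      norm_num; ring
    have hP := (hasDerivAt_besselP ha (r ^ 2 / 4)).comp r ht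
    have hQd := (hasDerivAt_besselQ ha (r ^ 2 / 4)).comp r ht
    refine ((hP.const_mul 2).div ((hasDerivAt_id r).mul hQd)
      (mul_ne_zero hr0 hQr)).congr_deriv ?_
    have h2 := mul_besselQ' a (r ^ 2 / 4)
    simp only [Pi.mul_apply, Function.comp_apply, id, hρ]
    generalize besselQ a (r ^ 2 / 4) = q at *
    generalize besselP a (r ^ 2 / 4) = p at *
    generalize besselQ' a (r ^ 2 / 4) = q' at *
    field_simp
    linear_combination (-4 * p) * h2
  obtain ⟨ξ, hξ, hξ'⟩ := exists_hasDerivAt_eq_slope (fun r => Real.arctan (ρ r))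
    (fun r => 1 / (1 + ρ r ^ 2) * (-1 - ρ r ^ 2 + (2 * a - 1) * ρ r / r))
    (by linarith : R < R + 8)
    (fun r hr => ((hderiv r hr.1).arctan).continuousAt.continuousWithinAt)
    (fun r hr => (hderiv r hr.1.le).arctan)
  have hξR : R ≤ ξ := hξ.1.le
  have hξ0 : 0 < ξ := by linarith
  have hpos : 0 < 1 + ρ ξ ^ 2 := by positivity
  have hle : (2 * a - 1) * ρ ξ / ξ ≤ (1 + ρ ξ ^ 2) / 2 := by
    rw [div_le_iff₀ hξ0]
    have h1 : (2 * a - 1) * ρ ξ ≤ ξ * |ρ ξ| := by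
      refine (le_abs_self _).trans ?_
      rw [abs_mul]
      exact mul_le_mul_of_nonneg_right (hR1.trans hξR) (abs_nonneg _)
    nlinarith [sq_nonneg (|ρ ξ| - 1), sq_abs (ρ ξ)]
  have hslope : 1 / (1 + ρ ξ ^ 2) * (-1 - ρ ξ ^ 2 + (2 * a - 1) * ρ ξ / ξ) ≤ -(1 / 2) := by
    rw [one_div_mul_eq_div, div_le_iff₀ hpos]
    linarith
  rw [hξ'] at hslope
  rw [show R + 8 - R = 8 by ring, div_le_iff₀ (by norm_num)] at hslope
  linarith [Real.neg_pi_div_two_lt_arctan (ρ (R + 8)), Real.arctan_lt_pi_div_two (ρ R),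
    Real.pi_lt_four]

/-- The zeros of `t Q(t)` on `[0, ∞)` are simple. -/
lemma besselQ_add_mul_ne_zero (ha : 0 < a) {t : ℝ} (ht : 0 ≤ t) (h0 : t * besselQ a t = 0) :
    besselQ a t + t * besselQ' a t ≠ 0 := by
  have hE := besselEnergy_pos ha ht
  rcases mul_eq_zero.1 h0 with rfl | hQ
  · simp [besselQ_zero]
  · rw [mul_besselQ', hQ]
    rw [hQ] at hE
    intro h
    rw [show besselP a t = 0 by linarith] at hE
    simp at hE

lemma hasDerivAt_mul_besselQ (ha : 0 < a) (t : ℝ) :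
    HasDerivAt (fun t => t * besselQ a t) (besselQ a t + t * besselQ' a t) t :=
  ((hasDerivAt_id t).mul (hasDerivAt_besselQ ha t)).congr_deriv (by simp)

/-- The zeros of `t Q(t)` on `[0, ∞)` form a strictly increasing sequence. -/
theorem exists_besselZeros (ha : 0 < a) : ∃ τ : ℕ → ℝ, StrictMono τ ∧ τ 0 = 0 ∧
    Set.range τ = {t | 0 ≤ t ∧ t * besselQ a t = 0} := by
  have hfin : ∀ T, ({t | 0 ≤ t ∧ t * besselQ a t = 0} ∩ Iic T).Finite := by
    -- an accumulation point would be a multiple zero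
    intro T
    by_contra hinf
    obtain ⟨x, hx, hacc⟩ := Set.Infinite.exists_accPt_of_subset_isCompact hinf
      (isCompact_Icc (a := 0) (b := T)) fun t ht => ⟨ht.1.1, ht.2⟩
    have hfreq : ∃ᶠ y in 𝓝[≠] x, y * besselQ a y = 0 :=
      (accPt_iff_frequently_nhdsNE.1 hacc).mono fun y hy => hy.1.2
    by_cases h0 : x * besselQ a x = 0
    · exact hfreq ((hasDerivAt_mul_besselQ ha x).eventually_ne
        (besselQ_add_mul_ne_zero ha hx.1 h0))
    · exact hfreq (((hasDerivAt_mul_besselQ ha x).continuousAt.eventually_ne h0).filter_mono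
        nhdsWithin_le_nhds)
  have hub : ∀ T, ∃ x ∈ {t | 0 ≤ t ∧ t * besselQ a t = 0}, T < x := by
    intro T
    obtain ⟨t, ht, h0⟩ := exists_besselQ_eq_zero ha |T|
    exact ⟨t, ⟨(abs_nonneg T).trans ht.le, by rw [h0, mul_zero]⟩, (le_abs_self T).trans_lt ht⟩
  obtain ⟨τ, hτ, hrange⟩ := exists_strictMono_range_eq hfin hub
  refine ⟨τ, hτ, ?_, hrange⟩
  have h0 : (0 : ℝ) ∈ Set.range τ := by rw [hrange]; simp
  obtain ⟨k, hk⟩ := h0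
  have h1 : τ 0 ∈ {t | 0 ≤ t ∧ t * besselQ a t = 0} := hrange ▸ mem_range_self 0
  exact le_antisymm (hk ▸ hτ.monotone (Nat.zero_le k)) h1.1

/-! ### Laguerre polynomials -/

lemma succ_mul_cast_choose_succ (j k : ℕ) :
    ((k : ℝ) + 1) * (j.choose (k + 1) : ℝ) = (j - k) * (j.choose k : ℝ) := by
  rcases le_or_gt k j with h | h
  · have := Nat.choose_succ_right_eq j k
    have h2 : ((j.choose (k + 1) * (k + 1) : ℕ) : ℝ) = (j.choose k * (j - k) : ℕ) := by rw [this]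
    rw [Nat.cast_mul, Nat.cast_mul, Nat.cast_sub h] at h2
    push_cast at h2
    linarith
  · simp [Nat.choose_eq_zero_of_lt h, Nat.choose_eq_zero_of_lt (h.trans k.lt_succ_self)]

lemma mul_cast_choose_pred (j k : ℕ) :
    (j : ℝ) * ((j - 1).choose k : ℝ) = (j - k) * (j.choose k : ℝ) := by
  cases j with
  | zero => cases k <;> simp
  | succ m =>
    rw [← succ_mul_cast_choose_succ, Nat.add_sub_cancel]
    have := Nat.add_one_mul_choose_eq m k
    have h2 : (((m + 1) * m.choose k : ℕ) : ℝ) = ((m + 1).choose (k + 1) * (k + 1) : ℕ) := by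
      rw [this]
    push_cast at h2 ⊢
    linarith

/-- The coefficients of `laguerre`. -/
def laguerreCoeff (a : ℝ) (n k : ℕ) : ℝ := (-1) ^ k * n.choose k / risingSucc a k

/-- The Laguerre polynomial `L_n^{(a)}`, normalized to have the value `1` at `0`. -/
def laguerre (a : ℝ) (n : ℕ) (μ : ℝ) : ℝ := powSum (laguerreCoeff a n) μ

lemma abs_div_risingSucc_le (ha : 0 < a) (x : ℝ) (k : ℕ) : |x / risingSucc a k| ≤ |x| := by
  have h := one_le_risingSucc ha k
  rw [abs_div, abs_of_pos (zero_lt_one.trans_le h)]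
  exact div_le_self (abs_nonneg x) h

lemma abs_laguerreCoeff_le (ha : 0 < a) (n k : ℕ) :
    |laguerreCoeff a n k| ≤ (n.factorial : ℝ) / k.factorial := by
  refine (abs_div_risingSucc_le ha _ k).trans ?_
  rw [abs_mul, abs_pow, abs_neg, abs_one, one_pow, one_mul, Nat.abs_cast,
    le_div_iff₀ (by positivity)]
  norm_cast
  rcases le_or_gt k n with h | h
  · rw [← Nat.choose_mul_factorial_mul_factorial h]
    exact Nat.le_mul_of_pos_right _ (Nat.factorial_pos _)
  · simp [Nat.choose_eq_zero_of_lt h]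

lemma laguerre_zero (μ : ℝ) : laguerre a 0 μ = 1 := by
  rw [laguerre, powSum, tsum_eq_single 0]
  · simp [laguerreCoeff, risingSucc]
  · intro k hk
    simp [laguerreCoeff, Nat.choose_eq_zero_of_lt (Nat.pos_of_ne_zero hk)]

/-- The three-term recurrence of the Laguerre polynomials. -/
lemma laguerre_recurrence (ha : 0 < a) (j : ℕ) (μ : ℝ) :
    (a + 2 * j + 1) * laguerre a j μ - j * laguerre a (j - 1) μ -
      (a + j + 1) * laguerre a (j + 1) μ = μ * laguerre a j μ := by
  have hs : ∀ n, HasSum (fun k => laguerreCoeff a n k * μ ^ k) (laguerre a n μ) := fun n =>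
    (summable_powSum (abs_laguerreCoeff_le ha n) μ).hasSum
  have h1 := (((hs j).mul_left (a + 2 * j + 1)).sub ((hs (j - 1)).mul_left (j : ℝ))).sub
    ((hs (j + 1)).mul_left (a + j + 1))
  rw [← hasSum_nat_add_iff' 1] at h1
  have h2 := h1.unique (((hs j).mul_left μ).congr_fun fun k => ?_)
  · rw [← h2]
    simp [laguerreCoeff, risingSucc]
    ring
  · have e1 := mul_cast_choose_pred j (k + 1)
    have e2 := succ_mul_cast_choose_succ j k
    have e3 : ((j + 1).choose (k + 1) : ℝ) = j.choose k + j.choose (k + 1) := by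
      rw [Nat.choose_succ_succ]; push_cast; rfl
    have h3 := (zero_lt_one.trans_le (one_le_risingSucc ha k)).ne'
    have h4 : a + 1 + k ≠ 0 := by positivity
    simp only [laguerreCoeff, risingSucc_succ, e3]
    push_cast at e1
    field_simp
    linear_combination (μ ^ (k + 1) * (-1) ^ k) * (e1 - e2)

/-- The Laguerre polynomial `L_j^{(a-1)}`, normalized to have the value `1` at `0`, in terms of those
with parameter `a`. -/
def laguerreY (a μ : ℝ) (j : ℕ) : ℝ :=
  ((a + j) * laguerre a j μ - j * laguerre a (j - 1) μ) / a

/-- The Laguerre polynomial with parameter `a`, with the normalization that goes with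
`laguerreY`. -/
def laguerreW (a μ : ℝ) (j : ℕ) : ℝ := μ / a * laguerre a j μ

lemma laguerreY_zero (ha : 0 < a) (μ : ℝ) : laguerreY a μ 0 = 1 := by
  simp [laguerreY, laguerre_zero, ha.ne']

lemma laguerreY_sub (ha : 0 < a) (μ : ℝ) (j : ℕ) :
    laguerreY a μ j - laguerreY a μ (j + 1) = laguerreW a μ j := by
  have := laguerre_recurrence ha j μ
  have ha' := ha.ne'
  simp only [laguerreY, laguerreW, Nat.add_sub_cancel]
  push_cast
  field_simp
  linear_combination this

lemma laguerreW_sub (ha : 0 < a) (μ : ℝ) (j : ℕ) :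
    (a + j) * laguerreW a μ j - j * laguerreW a μ (j - 1) = μ * laguerreY a μ j := by
  have ha' := ha.ne'
  simp only [laguerreY, laguerreW]
  field_simp

/-- The square root of `(a)ⱼ / j!`. -/
def laguerreWeight (a : ℝ) (j : ℕ) : ℝ := ∏ i ∈ Finset.range j, √(a + i) / √(i + 1)

lemma laguerreWeight_pos (ha : 0 < a) (j : ℕ) : 0 < laguerreWeight a j :=
  Finset.prod_pos fun i _ => by positivity

lemma laguerreWeight_succ (j : ℕ) :
    √(j + 1) * laguerreWeight a (j + 1) = √(a + j) * laguerreWeight a j := by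
  have : √((j : ℝ) + 1) ≠ 0 := by positivity
  rw [laguerreWeight, Finset.prod_range_succ, ← laguerreWeight]
  field_simp

lemma sqrt_mul_laguerreWeight_pred (j : ℕ) :
    √j * (√(a + (j - 1 : ℕ)) * laguerreWeight a (j - 1)) = j * laguerreWeight a j := by
  cases j with
  | zero => simp
  | succ m =>
    rw [Nat.add_sub_cancel, ← laguerreWeight_succ, ← mul_assoc, Nat.cast_succ,
      Real.mul_self_sqrt (by positivity)]

/-! ### The entries of the scaled matrix and of its discretization -/

lemma hardMeshSize_pos (ha : 0 < a) (n : ℕ) : 0 < hardMeshSize a n := by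
  unfold hardMeshSize; positivity

lemma flipMat_mul {n m : ℕ} (A : Matrix (Fin n) (Fin m) ℝ) (i : Fin n) (j : Fin m) :
    (flipMat n * A) i j = A i.rev j := by
  rw [Matrix.mul_apply, Finset.sum_eq_single i.rev]
  · have : (i : ℕ) + (i.rev : ℕ) + 1 = n := by rw [Fin.val_rev]; omega
    rw [flipMat, Matrix.of_apply, if_pos this, one_mul]
  · intro k _ hk
    have : ¬(i : ℕ) + (k : ℕ) + 1 = n := fun h => hk (by ext; rw [Fin.val_rev]; omega)
    simp [flipMat, this]
  · simp

lemma mul_flipMat {n m : ℕ} (A : Matrix (Fin m) (Fin n) ℝ) (i : Fin m) (j : Fin n) :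
    (A * flipMat n) i j = A i j.rev := by
  rw [Matrix.mul_apply, Finset.sum_eq_single j.rev]
  · have : (j.rev : ℕ) + (j : ℕ) + 1 = n := by rw [Fin.val_rev]; omega
    rw [flipMat, Matrix.of_apply, if_pos this, mul_one]
  · intro k _ hk
    have : ¬(k : ℕ) + (j : ℕ) + 1 = n := fun h => hk (by ext; rw [Fin.val_rev]; omega)
    simp [flipMat, this]
  · simp

/-- `M_hard` is upper bidiagonal, with diagonal `√(2/h) √(a + i)` and superdiagonal
`-√(2/h) √(i + 1)`. -/
lemma laguerreRectHard_apply (a : ℝ) (n : ℕ) (i : Fin n) (j : Fin (n + 1)) :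
    laguerreRectHard a n i j = √(2 / hardMeshSize a n) *
      (if (j : ℕ) = i then √(a + i) else if (j : ℕ) = i + 1 then -√((i : ℝ) + 1) else 0) := by
  have hi := i.isLt
  have hj := j.isLt
  rw [laguerreRectHard, Matrix.smul_apply, mul_flipMat, omegaMat, omegaMat, Matrix.mul_diagonal,
    Matrix.mul_assoc, flipMat_mul, Matrix.diagonal_mul, Matrix.transpose_apply, laguerreRect,
    Matrix.of_apply, smul_eq_mul, Fin.val_rev, Fin.val_rev, neg_mul, ← mul_neg]
  congr 1
  have hcast : ((n - (i + 1) : ℕ) : ℝ) = n - (i + 1) := by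
    rw [Nat.cast_sub (by omega)]; push_cast; rfl
  rw [hcast]
  by_cases h1 : (j : ℕ) = i
  · rw [if_pos h1, if_neg (by omega), if_pos (by omega),
      show n + 1 - (j + 1) + 1 = n - (i + 1) + 1 + 1 by omega,
      show a + n - 1 - (n - (i + 1) : ℝ) = a + i by ring, pow_succ (-1 : ℝ) (n - (i + 1) + 1)]
    have : ((-1 : ℝ) ^ (n - (i + 1) + 1)) * (-1) ^ (n - ((i : ℕ) + 1) + 1) = 1 := by
      rw [← pow_add, ← two_mul, pow_mul]; simp
    linear_combination √(a + i) * this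
  · rw [if_neg h1]
    by_cases h2 : (j : ℕ) = i + 1
    · rw [if_pos h2, if_pos (by omega), show n + 1 - (j + 1) + 1 = n - (i + 1) + 1 by omega,
        show (n : ℝ) - (n - (i + 1) : ℝ) = i + 1 by ring]
      have : ((-1 : ℝ) ^ (n - (i + 1) + 1)) * (-1) ^ (n - ((i : ℕ) + 1) + 1) = 1 := by
        rw [← pow_add, ← two_mul, pow_mul]; simp
      linear_combination -√((i : ℝ) + 1) * this
    · rw [if_neg h2, if_neg (by omega), if_neg (by omega)]
      simp

lemma besselDiscretization_apply (a : ℝ) (n : ℕ) (i : Fin n) (j : Fin (n + 1)) :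
    besselDiscretization a n i j =
      (if (j : ℕ) = i then √(hardMeshPoint a n (2 * (i + 1))) / hardMeshSize a n +
          (a - 1) / (2 * √(hardMeshPoint a n (2 * (i + 1))))
        else if (j : ℕ) = i + 1 then -(√(hardMeshPoint a n (2 * (i + 1))) / hardMeshSize a n) +
          (a - 1) / (2 * √(hardMeshPoint a n (2 * (i + 1))))
        else 0) := by
  have hsq : ∀ k : ℕ, ((-1 : ℝ) ^ k) ^ 2 = 1 := fun k => by rw [← pow_mul, mul_comm, pow_mul]; simp
  rw [besselDiscretization, interpMat, omegaMat, omegaMat, Matrix.add_apply, Matrix.smul_apply,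
    Matrix.smul_apply, Matrix.diagonal_mul, Matrix.diagonal_mul, Matrix.smul_apply,
    Matrix.smul_apply, Matrix.mul_diagonal, Matrix.diagonal_mul, nablaMat, Matrix.of_apply]
  simp only [smul_eq_mul]
  have hinv : ∀ x : ℝ, (a - 1) / (2 * x) = (a - 1) * (1 / x) / 2 := fun x => by
    rw [mul_one_div, div_div, mul_comm 2]
  have hinv' : ∀ x : ℝ, 1 / (2 * x) = 1 / x / 2 := fun x => by rw [div_div, mul_comm 2]
  rw [hinv, hinv', div_eq_mul_one_div _ (hardMeshSize a n)]
  by_cases h1 : (j : ℕ) = i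
  · simp only [if_pos h1]
    rw [h1]
    linear_combination (a - 1) * (1 / √(hardMeshPoint a n (2 * (i + 1)))) / 2 * hsq (i + 1)
  · simp only [if_neg h1]
    by_cases h2 : (j : ℕ) = i + 1
    · simp only [if_pos h2]
      rw [h2]
      linear_combination (a - 1) * (1 / √(hardMeshPoint a n (2 * (i + 1)))) / 2 * hsq (i + 1)
    · simp only [if_neg h2]
      ring

/-! ### The singular values of the scaled matrix -/

/-- The sequence that continues a vector by zeros. -/
def zeroExtend {m : ℕ} (y : Fin m → ℝ) (k : ℕ) : ℝ := if h : k < m then y ⟨k, h⟩ else 0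

lemma zeroExtend_val {m : ℕ} (y : Fin m → ℝ) (i : Fin m) : zeroExtend y i = y i := by
  simp [zeroExtend]

lemma sum_ite_val_eq {m : ℕ} (y : Fin m → ℝ) (c : ℝ) (k : ℕ) :
    ∑ i : Fin m, (if (i : ℕ) = k then c * y i else 0) = c * zeroExtend y k := by
  unfold zeroExtend
  split_ifs with h
  · rw [Finset.sum_eq_single ⟨k, h⟩]
    · simp
    · intro i _ hi
      rw [if_neg fun h' => hi (by ext; exact h')]
    · simp
  · rw [mul_zero]
    exact Finset.sum_eq_zero fun i _ => if_neg fun h' => h (by omega)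

lemma laguerreRectHard_mulVec (a : ℝ) (n : ℕ) (y : Fin (n + 1) → ℝ) (i : Fin n) :
    (laguerreRectHard a n *ᵥ y) i = √(2 / hardMeshSize a n) *
      (√(a + i) * zeroExtend y i - √((i : ℝ) + 1) * zeroExtend y (i + 1)) := by
  rw [Matrix.mulVec, dotProduct, ← sum_ite_val_eq, ← sum_ite_val_eq, ← Finset.sum_sub_distrib, Finset.mul_sum]
  refine Finset.sum_congr rfl fun j _ => ?_
  rw [laguerreRectHard_apply, mul_assoc]
  congr 1
  split_ifs <;> first | omega | ring

lemma laguerreRectHard_transpose_mulVec (a : ℝ) (n : ℕ) (w : Fin n → ℝ) (j : Fin (n + 1)) :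
    ((laguerreRectHard a n)ᵀ *ᵥ w) j = √(2 / hardMeshSize a n) *
      (√(a + j) * zeroExtend w j - √(j : ℝ) * zeroExtend w (j - 1)) := by
  rw [Matrix.mulVec, dotProduct, ← sum_ite_val_eq, ← sum_ite_val_eq, ← Finset.sum_sub_distrib, Finset.mul_sum]
  refine Finset.sum_congr rfl fun i _ => ?_
  rw [Matrix.transpose_apply, laguerreRectHard_apply, mul_assoc]
  congr 1
  by_cases h1 : (i : ℕ) = j
  · rw [if_pos h1.symm, if_pos h1, h1]
    by_cases h2 : (j : ℕ) = j - 1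
    · have h3 : (j : ℕ) = 0 := by omega
      simp [h3]
    · rw [if_neg h2, sub_zero]
  · rw [if_neg (Ne.symm h1), if_neg h1]
    by_cases h2 : (j : ℕ) = i + 1
    · rw [if_pos h2, if_pos (by omega), h2]
      push_cast
      ring
    · rw [if_neg h2]
      by_cases h3 : (i : ℕ) = j - 1
      · have h4 : (j : ℕ) = 0 := by omega
        simp [h4]
      · rw [if_neg h3]
        ring

/-- The eigenvector of `Mᵀ M`, for `M = M_hard`, that belongs to `μ`: the Laguerre polynomials at
`μ`, in the orthonormal normalization up to a common factor. -/
def laguerreVec (a μ : ℝ) (n : ℕ) (j : Fin (n + 1)) : ℝ := laguerreWeight a j * laguerreY a μ j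

lemma zeroExtend_laguerreVec (μ : ℝ) {n k : ℕ} (hk : k ≤ n) :
    zeroExtend (laguerreVec a μ n) k = laguerreWeight a k * laguerreY a μ k := by
  rw [zeroExtend, dif_pos (Nat.lt_succ_of_le hk), laguerreVec]

lemma laguerreRectHard_mulVec_laguerreVec (ha : 0 < a) (μ : ℝ) (n : ℕ) (i : Fin n) :
    (laguerreRectHard a n *ᵥ laguerreVec a μ n) i =
      √(2 / hardMeshSize a n) * (√(a + i) * laguerreWeight a i * laguerreW a μ i) := by
  rw [laguerreRectHard_mulVec, zeroExtend_laguerreVec μ i.isLt.le,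
    zeroExtend_laguerreVec μ (Nat.succ_le_of_lt i.isLt), ← laguerreY_sub ha]
  linear_combination -(√(2 / hardMeshSize a n) * laguerreY a μ (i + 1)) *
    laguerreWeight_succ (a := a) i

lemma sq_sqrt_two_div_hardMeshSize (ha : 0 < a) (n : ℕ) :
    √(2 / hardMeshSize a n) * √(2 / hardMeshSize a n) = 2 / hardMeshSize a n :=
  Real.mul_self_sqrt (div_pos two_pos (hardMeshSize_pos ha n)).le

/-- The last equation of the eigenvalue problem holds because the Laguerre polynomial of degree `n`
vanishes at `μ`. -/
lemma transpose_mulVec_mulVec_laguerreVec (ha : 0 < a) {μ : ℝ} {n : ℕ}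
    (h0 : laguerreW a μ n = 0) :
    (laguerreRectHard a n)ᵀ *ᵥ (laguerreRectHard a n *ᵥ laguerreVec a μ n) =
      (2 / hardMeshSize a n * μ) • laguerreVec a μ n := by
  set β := √(2 / hardMeshSize a n) with hβ
  have hw : ∀ k, k ≤ n → zeroExtend (laguerreRectHard a n *ᵥ laguerreVec a μ n) k =
      β * (√(a + k) * laguerreWeight a k * laguerreW a μ k) := by
    intro k hk
    rcases hk.lt_or_eq with h | rfl
    · rw [zeroExtend, dif_pos h, laguerreRectHard_mulVec_laguerreVec ha]
    · rw [zeroExtend, dif_neg (lt_irrefl _), h0, mul_zero, mul_zero]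
  ext j
  have hj : (j : ℕ) ≤ n := Nat.le_of_lt_succ j.isLt
  rw [laguerreRectHard_transpose_mulVec, hw j hj, hw (j - 1) (by omega), Pi.smul_apply,
    smul_eq_mul, laguerreVec, ← hβ, ← sq_sqrt_two_div_hardMeshSize ha, ← hβ]
  have e1 : √(a + (j : ℕ)) * √(a + (j : ℕ)) = a + j := Real.mul_self_sqrt (by positivity)
  have e2 := sqrt_mul_laguerreWeight_pred (a := a) j
  have e3 := laguerreW_sub ha μ j
  linear_combination (β * β * laguerreWeight a j * laguerreW a μ j) * e1
    - (β * β * laguerreW a μ (j - 1)) * e2 + (β * β * laguerreWeight a j) * e3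

/-- An eigenvector of `Mᵀ M` satisfies the recurrence of the Laguerre polynomials, hence is
determined by its first component. -/
lemma eq_laguerreVec_of_transpose_mulVec_mulVec (ha : 0 < a) {μ : ℝ} {n : ℕ}
    {y : Fin (n + 1) → ℝ} (hy : (laguerreRectHard a n)ᵀ *ᵥ (laguerreRectHard a n *ᵥ y) =
      (2 / hardMeshSize a n * μ) • y) :
    y = y 0 • laguerreVec a μ n ∧ (y ≠ 0 → laguerreW a μ n = 0) := by
  set β := √(2 / hardMeshSize a n) with hβ
  have hβ0 : β ≠ 0 := (Real.sqrt_pos.2 (div_pos two_pos (hardMeshSize_pos ha n))).ne'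
  set w := laguerreRectHard a n *ᵥ y with hw
  have h1 : ∀ k, k < n → zeroExtend w k =
      β * (√(a + k) * zeroExtend y k - √((k : ℝ) + 1) * zeroExtend y (k + 1)) := by
    intro k hk
    rw [zeroExtend, dif_pos hk, hw, laguerreRectHard_mulVec]
  have h2 : ∀ k, k ≤ n → √(a + k) * zeroExtend w k - √(k : ℝ) * zeroExtend w (k - 1) =
      β * (μ * zeroExtend y k) := by
    intro k hk
    have h := congrFun hy ⟨k, Nat.lt_succ_of_le hk⟩
    rw [laguerreRectHard_transpose_mulVec, Pi.smul_apply, smul_eq_mul, ← hβ,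
      ← sq_sqrt_two_div_hardMeshSize ha, ← hβ, mul_assoc, mul_assoc] at h
    have := mul_left_cancel₀ hβ0 h
    rw [this, ← zeroExtend_val y]
  -- the second equation follows from the first and from the second one for `k - 1`
  have step : ∀ k, k ≤ n → zeroExtend y k = y 0 * (laguerreWeight a k * laguerreY a μ k) →
      √(k : ℝ) * zeroExtend w (k - 1) = √(k : ℝ) * (y 0 * (β * (√(a + (k - 1 : ℕ)) *
        laguerreWeight a (k - 1) * laguerreW a μ (k - 1)))) →
      zeroExtend w k = y 0 * (β * (√(a + k) * laguerreWeight a k * laguerreW a μ k)) := by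
    intro k hk hyk hwk
    have hs : √(a + (k : ℝ)) ≠ 0 := by positivity
    have e1 : √(a + (k : ℕ)) * √(a + (k : ℕ)) = a + k := Real.mul_self_sqrt (by positivity)
    have e2 := sqrt_mul_laguerreWeight_pred (a := a) k
    have e3 := laguerreW_sub ha μ k
    have e4 := h2 k hk
    refine mul_left_cancel₀ hs ?_
    rw [hyk, hwk] at e4
    linear_combination e4 - (y 0 * β * laguerreWeight a k * laguerreW a μ k) * e1
      + (y 0 * β * laguerreW a μ (k - 1)) * e2 - (y 0 * β * laguerreWeight a k) * e3
  have key : ∀ k, k ≤ n → zeroExtend y k = y 0 * (laguerreWeight a k * laguerreY a μ k) ∧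
      zeroExtend w k = y 0 * (β * (√(a + k) * laguerreWeight a k * laguerreW a μ k)) := by
    intro k hk
    induction k with
    | zero =>
      have hy0 : zeroExtend y 0 = y 0 * (laguerreWeight a 0 * laguerreY a μ 0) := by
        rw [laguerreY_zero ha, laguerreWeight, Finset.prod_range_zero, mul_one, mul_one]
        exact zeroExtend_val y 0
      exact ⟨hy0, step 0 hk hy0 (by simp)⟩
    | succ k ih =>
      obtain ⟨i1, i2⟩ := ih (Nat.le_of_succ_le hk)
      have hyk : zeroExtend y (k + 1) =
          y 0 * (laguerreWeight a (k + 1) * laguerreY a μ (k + 1)) := by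
        have h := h1 k hk
        rw [i2, i1] at h
        have hs' : √((k : ℝ) + 1) ≠ 0 := by positivity
        refine mul_left_cancel₀ (mul_ne_zero hβ0 hs') ?_
        have e5 := laguerreWeight_succ (a := a) k
        have e6 := laguerreY_sub ha μ k
        linear_combination h + (β * y 0 * √(a + k) * laguerreWeight a k) * e6
          - (β * y 0 * laguerreY a μ (k + 1)) * e5
      exact ⟨hyk, step (k + 1) hk hyk (by rw [Nat.add_sub_cancel, i2])⟩
  have hy' : y = y 0 • laguerreVec a μ n := by
    ext j
    rw [← zeroExtend_val y j, (key j (Nat.le_of_lt_succ j.isLt)).1, Pi.smul_apply, smul_eq_mul,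
      laguerreVec]
  refine ⟨hy', fun hne => ?_⟩
  have h := (key n le_rfl).2
  rw [zeroExtend, dif_neg (lt_irrefl _)] at h
  have hy0 : y 0 ≠ 0 := fun h0 => hne (by rw [hy', h0, zero_smul])
  have hs : √(a + (n : ℝ)) ≠ 0 := by positivity
  have hwt := (laguerreWeight_pos ha n).ne'
  simpa [hy0, hβ0, hs, hwt] using h.symm

/-- The linear map with matrix `M_hard`. -/
abbrev hardMap (a : ℝ) (n : ℕ) : EuclideanSpace ℝ (Fin (n + 1)) →ₗ[ℝ] EuclideanSpace ℝ (Fin n) :=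
  Matrix.toEuclideanLin (laguerreRectHard a n)

lemma ofLp_adjoint_comp_hardMap (n : ℕ) (y : EuclideanSpace ℝ (Fin (n + 1))) :
    WithLp.ofLp ((LinearMap.adjoint (hardMap a n) ∘ₗ hardMap a n) y) =
      (laguerreRectHard a n)ᵀ *ᵥ (laguerreRectHard a n *ᵥ WithLp.ofLp y) := by
  rw [hardMap, ← Matrix.toEuclideanLin_conjTranspose_eq_adjoint,
    Matrix.conjTranspose_eq_transpose_of_trivial]
  rfl

lemma laguerreVec_ne_zero (ha : 0 < a) (μ : ℝ) (n : ℕ) : laguerreVec a μ n ≠ 0 := by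
  intro h
  have := congrFun h 0
  simp [laguerreVec, laguerreWeight, laguerreY_zero ha] at this

lemma hasEigenvector_hardMap_iff (n : ℕ) (μ : ℝ) (y : EuclideanSpace ℝ (Fin (n + 1))) :
    Module.End.HasEigenvector (LinearMap.adjoint (hardMap a n) ∘ₗ hardMap a n)
      (2 / hardMeshSize a n * μ) y ↔
    (laguerreRectHard a n)ᵀ *ᵥ (laguerreRectHard a n *ᵥ WithLp.ofLp y) =
      (2 / hardMeshSize a n * μ) • WithLp.ofLp y ∧ WithLp.ofLp y ≠ 0 := by
  rw [Module.End.hasEigenvector_iff, Module.End.mem_eigenspace_iff,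
    ← ofLp_adjoint_comp_hardMap]
  exact and_congr (WithLp.ofLp_injective 2).eq_iff.symm (not_congr (WithLp.ofLp_eq_zero 2).symm)

lemma two_div_mul_mul_div_two (ha : 0 < a) (n : ℕ) (x : ℝ) :
    2 / hardMeshSize a n * (hardMeshSize a n / 2 * x) = x := by
  have := (hardMeshSize_pos ha n).ne'
  field_simp

/-- The squared singular values of `M_hard` correspond to the zeros of `μ L_n^{(a)}(μ)`. -/
lemma laguerreW_sq_singularValues (ha : 0 < a) {n i : ℕ} (hi : i < n + 1) :
    laguerreW a (hardMeshSize a n / 2 * (hardMap a n).singularValues i ^ 2) n = 0 := by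
  have h := (hardMap a n).hasEigenvalue_adjoint_comp_self_sq_singularValues (n := i)
    (by rwa [finrank_euclideanSpace_fin])
  obtain ⟨y, hy⟩ := h.exists_hasEigenvector
  rw [RCLike.ofReal_real_eq_id, id,
    ← two_div_mul_mul_div_two ha n ((hardMap a n).singularValues i ^ 2), hasEigenvector_hardMap_iff] at hy
  exact (eq_laguerreVec_of_transpose_mulVec_mulVec ha hy.1).2 hy.2

lemma exists_sq_singularValues_eq (ha : 0 < a) {n : ℕ} {μ : ℝ} (h0 : laguerreW a μ n = 0) :
    ∃ i < n + 1, (hardMap a n).singularValues i ^ 2 = 2 / hardMeshSize a n * μ := by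
  have h : Module.End.HasEigenvector (LinearMap.adjoint (hardMap a n) ∘ₗ hardMap a n)
      (2 / hardMeshSize a n * μ) (WithLp.toLp 2 (laguerreVec a μ n)) :=
    (hasEigenvector_hardMap_iff n μ _).2
      ⟨transpose_mulVec_mulVec_laguerreVec ha h0, laguerreVec_ne_zero ha μ n⟩
  obtain ⟨i, hi⟩ := (hardMap a n).isSymmetric_adjoint_comp_self.exists_eigenvalues_eq
    finrank_euclideanSpace_fin (Module.End.hasEigenvalue_of_hasEigenvector h)
  refine ⟨i, i.isLt, ?_⟩
  rw [(hardMap a n).sq_singularValues_fin finrank_euclideanSpace_fin]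
  exact hi

/-- The squared singular values are simple, because the eigenspaces of `Mᵀ M` are
one-dimensional. -/
lemma sq_singularValues_strictAnti (ha : 0 < a) {n i j : ℕ} (hij : i < j) (hj : j < n + 1) :
    (hardMap a n).singularValues j ^ 2 < (hardMap a n).singularValues i ^ 2 := by
  have hle := (hardMap a n).singularValues_antitone hij.le
  have h0 := (hardMap a n).singularValues_nonneg j
  refine lt_of_le_of_ne (pow_le_pow_left₀ h0 hle 2) fun heq => ?_
  have hsym := (hardMap a n).isSymmetric_adjoint_comp_self
  have hn : Module.finrank ℝ (EuclideanSpace ℝ (Fin (n + 1))) = n + 1 := finrank_euclideanSpace_fin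
  have hi : i < n + 1 := hij.trans hj
  set v := hsym.eigenvectorBasis hn
  have hvec : ∀ k (hk : k < n + 1), (hardMap a n).singularValues k ^ 2 =
      (hardMap a n).singularValues j ^ 2 →
      ∃ r : ℝ, v ⟨k, hk⟩ = r • WithLp.toLp 2 (laguerreVec a
        (hardMeshSize a n / 2 * (hardMap a n).singularValues j ^ 2) n) := by
    intro k hk hkj
    have h := hsym.hasEigenvector_eigenvectorBasis hn ⟨k, hk⟩
    rw [← (hardMap a n).sq_singularValues_of_lt hn hk, hkj, RCLike.ofReal_real_eq_id, id,
      ← two_div_mul_mul_div_two ha n ((hardMap a n).singularValues j ^ 2), hasEigenvector_hardMap_iff] at h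
    exact ⟨_, (WithLp.ofLp_injective 2) (eq_laguerreVec_of_transpose_mulVec_mulVec ha h.1).1⟩
  obtain ⟨r, hr⟩ := hvec i hi heq.symm
  obtain ⟨s, hs⟩ := hvec j hj rfl
  have hr0 : r ≠ 0 := by
    rintro rfl
    exact v.orthonormal.ne_zero ⟨i, hi⟩ (by rw [hr, zero_smul])
  have hs0 : s ≠ 0 := by
    rintro rfl
    exact v.orthonormal.ne_zero ⟨j, hj⟩ (by rw [hs, zero_smul])
  have horth := v.orthonormal.inner_eq_zero (i := ⟨i, hi⟩) (j := ⟨j, hj⟩)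
    (fun h => hij.ne (congrArg Fin.val h))
  rw [hr, hs, inner_smul_left, inner_smul_right] at horth
  refine laguerreVec_ne_zero ha (hardMeshSize a n / 2 * (hardMap a n).singularValues j ^ 2) n ?_
  simpa [hr0, hs0] using horth

/-! ### The hard edge limit -/

/-- The coefficients of `L_n^{(a)}(2 h t)` as a polynomial in `t`. -/
def scaledCoeff (a : ℝ) (n k : ℕ) : ℝ := laguerreCoeff a n k * (2 * hardMeshSize a n) ^ k

lemma laguerre_scaled (a : ℝ) (n : ℕ) (t : ℝ) :
    laguerre a n (2 * hardMeshSize a n * t) = powSum (scaledCoeff a n) t :=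
  tsum_congr fun k => by rw [scaledCoeff, mul_pow, mul_assoc]

lemma two_mul_hardMeshSize_mul_le (ha : 0 < a) (n : ℕ) : 2 * hardMeshSize a n * n ≤ 1 := by
  rw [hardMeshSize, mul_one_div, div_mul_eq_mul_div, div_le_one (by positivity)]
  linarith

lemma abs_scaledCoeff_le (ha : 0 < a) (n k : ℕ) : |scaledCoeff a n k| ≤ 1 / k.factorial := by
  have hh := (hardMeshSize_pos ha n).le
  rw [scaledCoeff, abs_mul, abs_of_nonneg (by positivity : 0 ≤ (2 * hardMeshSize a n) ^ k)]
  have h1 : |laguerreCoeff a n k| ≤ (n : ℝ) ^ k / k.factorial := by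
    refine (abs_div_risingSucc_le ha _ k).trans ?_
    rw [abs_mul, abs_pow, abs_neg, abs_one, one_pow, one_mul, Nat.abs_cast]
    exact Nat.choose_le_pow_div k n
  calc |laguerreCoeff a n k| * (2 * hardMeshSize a n) ^ k
      ≤ (n : ℝ) ^ k / k.factorial * (2 * hardMeshSize a n) ^ k := by gcongr
    _ = (2 * hardMeshSize a n * n) ^ k / k.factorial := by rw [mul_pow _ (n : ℝ)]; ring
    _ ≤ 1 / k.factorial := by
      gcongr
      exact pow_le_one₀ (by positivity) (two_mul_hardMeshSize_mul_le ha n)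

lemma tendsto_scaledCoeff (a : ℝ) (k : ℕ) :
    Tendsto (scaledCoeff a · k) atTop (𝓝 (besselCoeff a k)) := by
  have hden : Tendsto (fun n : ℕ => 2 * (n : ℝ) + a + 1) atTop atTop :=
    tendsto_atTop_add_const_right _ _ (tendsto_atTop_add_const_right _ _
      (tendsto_natCast_atTop_atTop.const_mul_atTop two_pos))
  have hfac : ∀ j : ℕ, Tendsto (fun n : ℕ => 2 * hardMeshSize a n * (n - j)) atTop (𝓝 1) := by
    intro j
    have h1 : Tendsto (fun n : ℕ => 1 - (a + 1 + 2 * j) / (2 * (n : ℝ) + a + 1)) atTop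
        (𝓝 (1 - 0)) := tendsto_const_nhds.sub (hden.const_div_atTop _)
    rw [sub_zero] at h1
    refine h1.congr' ?_
    filter_upwards [hden.eventually_gt_atTop 0] with n hn
    rw [hardMeshSize]
    field_simp
    ring
  have hchoose : Tendsto (fun n : ℕ => (n.choose k : ℝ) * (2 * hardMeshSize a n) ^ k) atTop
      (𝓝 (1 / k.factorial)) := by
    induction k with
    | zero => simp
    | succ k ih =>
      have hk : (k : ℝ) + 1 ≠ 0 := by positivity
      have h := ((ih.mul (hfac k)).div_const ((k : ℝ) + 1))
      rw [Nat.factorial_succ, mul_comm (k + 1), Nat.cast_mul, Nat.cast_succ, ← div_div]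
      rw [mul_one] at h
      refine h.congr fun n => ?_
      rw [div_eq_iff hk]
      linear_combination (-(2 * hardMeshSize a n) ^ (k + 1)) * succ_mul_cast_choose_succ n k
  have h := (hchoose.const_mul ((-1) ^ k)).div_const (risingSucc a k)
  rw [mul_one_div, div_div] at h
  refine h.congr fun n => ?_
  rw [scaledCoeff, laguerreCoeff]
  ring

/-- The `(k + 1)`-th least singular value of `M_hard` converges to `2 √t`, where `t` is the
`(k + 1)`-th positive zero of `Q`. -/
theorem tendsto_kthLeastSingularValue (ha : 0 < a) {τ : ℕ → ℝ} (hτ : StrictMono τ) (hτ0 : τ 0 = 0)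
    (hrange : Set.range τ = {t | 0 ≤ t ∧ t * besselQ a t = 0}) (k : ℕ) :
    Tendsto (fun n : ℕ => kthLeastSingularValue (laguerreRectHard a n) (k + 1)) atTop
      (𝓝 (2 * √(τ (k + 1)))) := by
  set b : ℕ → ℕ → ℝ := fun n k => (hardMap a n).singularValues (n - k) ^ 2 / 4 with hb
  have hder : ∀ n t, HasDerivAt (fun t => t * powSum (scaledCoeff a n) t)
      (powSum (scaledCoeff a n) t + t * powSum (derivCoeff (scaledCoeff a n)) t) t := fun n t =>
    ((hasDerivAt_id t).mul (hasDerivAt_powSum (abs_scaledCoeff_le ha n) t)).congr_deriv (by simp)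
  have hlim := tendsto_powSum (abs_scaledCoeff_le ha) (tendsto_scaledCoeff a)
  have hlim' := tendsto_powSum (fun n => abs_derivCoeff_le (abs_scaledCoeff_le ha n))
    (tendsto_derivCoeff (tendsto_scaledCoeff a))
  have hW : ∀ n t, laguerreW a (hardMeshSize a n / 2 * (4 * t)) n = 0 ↔
      t * powSum (scaledCoeff a n) t = 0 := by
    intro n t
    rw [show hardMeshSize a n / 2 * (4 * t) = 2 * hardMeshSize a n * t by ring, laguerreW,
      laguerre_scaled]
    simp [(hardMeshSize_pos ha n).ne', ha.ne']
  have hfour : ∀ n k, 4 * b n k = (hardMap a n).singularValues (n - k) ^ 2 := fun n k => by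
    simp only [hb]; ring
  have hcover : ∀ n z, z * powSum (scaledCoeff a n) z = 0 →
      ∃ i < n + 1, (hardMap a n).singularValues i ^ 2 = 4 * z := by
    intro n z hz
    obtain ⟨i, hi, h⟩ := exists_sq_singularValues_eq ha ((hW n z).2 hz)
    exact ⟨i, hi, by rw [h, two_div_mul_mul_div_two ha]⟩
  have hlimb := tendsto_zeros (b := b) (k := k + 1) (hasDerivAt_mul_besselQ ha) hder
    (fun t => tendsto_snd.mul (hlim t)) (fun t => (hlim t).add (tendsto_snd.mul (hlim' t))) hτ
    (fun t ht => ?_) (fun k => ?_) (fun n => ?_) (fun n k hk => ?_) (fun n k hk => ?_)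
    (fun n k z hk hz hz0 => ?_)
  · refine (hlimb.sqrt.const_mul 2).congr' ?_
    filter_upwards [eventually_gt_atTop k] with n hn
    rw [kthLeastSingularValue, min_eq_left n.le_succ]
    have h0 := (hardMap a n).singularValues_nonneg (n - (k + 1))
    rw [show b n (k + 1) = ((hardMap a n).singularValues (n - (k + 1)) / 2) ^ 2 by
      simp only [hb]; ring, Real.sqrt_sq (by positivity)]
    ring
  · rw [hτ0] at ht
    have h : t ∈ Set.range τ ↔ t ∈ {t | 0 ≤ t ∧ t * besselQ a t = 0} := by rw [hrange]
    exact ⟨fun h0 => h.2 ⟨ht, h0⟩, fun h0 => (h.1 h0).2⟩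
  · have h : τ k ∈ {t | 0 ≤ t ∧ t * besselQ a t = 0} := hrange ▸ mem_range_self k
    exact besselQ_add_mul_ne_zero ha h.1 h.2
  · obtain ⟨i, hi, h⟩ := hcover n 0 (zero_mul _)
    rw [mul_zero, sq_eq_zero_iff] at h
    have h1 := (hardMap a n).singularValues_antitone (Nat.le_of_lt_succ hi)
    have h2 := (hardMap a n).singularValues_nonneg n
    have h3 : (hardMap a n).singularValues n = 0 := le_antisymm (h1.trans h.le) h2
    simp [hb, h3, hτ0]
  · rw [← hW, hfour]
    exact laguerreW_sq_singularValues ha (by omega)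
  · have := sq_singularValues_strictAnti ha (n := n) (i := n - (k + 1)) (j := n - k) (by omega)
      (by omega)
    rw [← hfour, ← hfour] at this
    linarith
  · obtain ⟨i, hi, h⟩ := hcover n z hz0
    have hik : i ≤ n - (k + 1) := by
      by_contra! hlt
      have h1 := (hardMap a n).singularValues_antitone (show n - k ≤ i by omega)
      have h2 := pow_le_pow_left₀ ((hardMap a n).singularValues_nonneg i) h1 2
      rw [← hfour, h] at h2
      linarith
    have h1 := pow_le_pow_left₀ ((hardMap a n).singularValues_nonneg _)
      ((hardMap a n).singularValues_antitone hik) 2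
    rw [← hfour, h] at h1
    linarith

/-! ### The singular functions of the Bessel operator -/

/-- The equations `J_{a-1} v = s u` and `J_{a-1}* u = s v` on `(0,1)`, solved for the
derivatives. -/
def SolvesBesselSystem (a s : ℝ) (v u : ℝ → ℝ) : Prop :=
  ∀ x ∈ Ioo (0 : ℝ) 1, HasDerivAt v ((a - 1) / (2 * x) * v x - s / (2 * √x) * u x) x ∧
    HasDerivAt u (s / (2 * √x) * v x - a / (2 * x) * u x) x

lemma IsBesselSingularTripleII.solvesBesselSystem {s : ℝ} {v u : ℝ → ℝ}
    (h : IsBesselSingularTripleII (a - 1) s v u) : SolvesBesselSystem a s v u := by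
  intro x hx
  have hq : 0 < √x := Real.sqrt_pos.2 hx.1
  have hxq : x = √x * √x := (Real.mul_self_sqrt hx.1.le).symm
  have h1 := h.action x hx
  have h2 := h.adjoint_action x hx
  simp only [besselAction, besselAdjointAction] at h1 h2
  constructor
  · refine (h.mem_domain.differentiable x hx).hasDerivAt.congr_deriv ?_
    generalize √x = q at *
    generalize deriv v x = v' at *
    generalize v x = y at *
    subst hxq
    field_simp at h1 ⊢
    linear_combination -h1
  · refine (h.differentiable x hx).hasDerivAt.congr_deriv ?_
    generalize √x = q at *
    generalize deriv u x = v' at *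
    generalize u x = y at *
    subst hxq
    field_simp at h2 ⊢
    linear_combination h2

/-- Abel's identity: `√x` times the Wronskian of two solutions is constant. -/
lemma SolvesBesselSystem.wronskian_eq {s : ℝ} {v u V U : ℝ → ℝ} (h : SolvesBesselSystem a s v u)
    (H : SolvesBesselSystem a s V U) {x y : ℝ} (hx : x ∈ Ioo (0 : ℝ) 1) (hy : y ∈ Ioo (0 : ℝ) 1) :
    √x * (v x * U x - V x * u x) = √y * (v y * U y - V y * u y) := by
  have hder : ∀ x ∈ Ioo (0 : ℝ) 1,
      HasDerivAt (fun x => √x * (v x * U x - V x * u x)) 0 x := by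
    intro x hx
    obtain ⟨h1, h2⟩ := h x hx
    obtain ⟨H1, H2⟩ := H x hx
    refine ((Real.hasDerivAt_sqrt hx.1.ne').mul ((h1.mul H2).sub (H1.mul h2))).congr_deriv ?_
    have hq : 0 < √x := Real.sqrt_pos.2 hx.1
    have hxq : x = √x * √x := (Real.mul_self_sqrt hx.1.le).symm
    simp only [Pi.sub_apply, Pi.mul_apply]
    generalize v x = v₀ at *
    generalize u x = u₀ at *
    generalize V x = V₀ at *
    generalize U x = U₀ at *
    generalize √x = q at *
    subst hxq
    field_simp
    ring
  exact isOpen_Ioo.is_const_of_deriv_eq_zero isPreconnected_Ioo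
    (fun x hx => (hder x hx).differentiableAt.differentiableWithinAt)
    (fun x hx => (hder x hx).deriv) hx hy

/-- Two solutions whose Wronskian vanishes are proportional, if the second has no zero. -/
lemma SolvesBesselSystem.exists_eq_mul {s : ℝ} {v u V U : ℝ → ℝ} (h : SolvesBesselSystem a s v u)
    (H : SolvesBesselSystem a s V U) (hW : ∀ x ∈ Ioo (0 : ℝ) 1, v x * U x = V x * u x)
    (hpos : ∀ x ∈ Ioo (0 : ℝ) 1, 0 < V x ^ 2 + U x ^ 2) :
    ∃ r : ℝ, ∀ x ∈ Ioo (0 : ℝ) 1, v x = r * V x ∧ u x = r * U x := by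
  set ρ : ℝ → ℝ := fun x => (v x * V x + u x * U x) / (V x ^ 2 + U x ^ 2) with hρ
  have hder : ∀ x ∈ Ioo (0 : ℝ) 1, HasDerivAt ρ 0 x := by
    intro x hx
    obtain ⟨h1, h2⟩ := h x hx
    obtain ⟨H1, H2⟩ := H x hx
    have hp := (hpos x hx).ne'
    refine (((h1.mul H1).add (h2.mul H2)).div ((H1.pow 2).add (H2.pow 2)) hp).congr_deriv ?_
    refine div_eq_zero_iff.2 (Or.inl ?_)
    simp only [Pi.add_apply, Pi.mul_apply, Pi.pow_apply]
    push_cast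
    linear_combination (2 * V x * U x * ((a - 1) / (2 * x) + a / (2 * x))) * hW x hx
  have h2 : (1 / 2 : ℝ) ∈ Ioo (0 : ℝ) 1 := by norm_num
  refine ⟨ρ (1 / 2), fun x hx => ?_⟩
  have hp := (hpos x hx).ne'
  rw [← isOpen_Ioo.is_const_of_deriv_eq_zero isPreconnected_Ioo
    (fun x hx => (hder x hx).differentiableAt.differentiableWithinAt)
    (fun x hx => (hder x hx).deriv) hx h2]
  simp only [hρ]
  constructor
  · field_simp
    linear_combination U x * hW x hx
  · field_simp
    linear_combination -V x * hW x hx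

/-- The left singular function for `s`: up to a constant factor it is `J_a(s √x)`. -/
def besselU (a s x : ℝ) : ℝ := x ^ (a / 2) * besselQ a (s ^ 2 * x / 4)

/-- The right singular function for `s`: up to the same constant factor as for `besselU` it is
`J_{a-1}(s √x)`. -/
def besselV (a s x : ℝ) : ℝ := 2 / s * (x ^ ((a - 1) / 2) * besselP a (s ^ 2 * x / 4))

lemma rpow_div_two_eq {x : ℝ} (hx : 0 < x) (a : ℝ) : x ^ (a / 2) = x ^ ((a - 1) / 2) * √x := by
  rw [Real.sqrt_eq_rpow, ← Real.rpow_add hx]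
  ring_nf

lemma solvesBesselSystem_besselV_besselU (ha : 0 < a) {s : ℝ} (hs : 0 < s) :
    SolvesBesselSystem a s (besselV a s) (besselU a s) := by
  intro x hx
  have hx0 := hx.1
  have hq : 0 < √x := Real.sqrt_pos.2 hx.1
  have hxq : x = √x * √x := (Real.mul_self_sqrt hx.1.le).symm
  have ht : HasDerivAt (fun x => s ^ 2 * x / 4) (s ^ 2 / 4) x := by
    simpa using ((hasDerivAt_id x).const_mul (s ^ 2)).div_const 4
  have hP := (hasDerivAt_besselP ha (s ^ 2 * x / 4)).comp x ht
  have hQ := (hasDerivAt_besselQ ha (s ^ 2 * x / 4)).comp x ht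
  have hpow : ∀ p : ℝ, HasDerivAt (fun x : ℝ => x ^ p) (p * (x ^ p / x)) x := fun p => by
    refine (Real.hasDerivAt_rpow_const (Or.inl hx0.ne')).congr_deriv ?_
    rw [Real.rpow_sub_one hx0.ne']
  have hQ' := mul_besselQ' a (s ^ 2 * x / 4)
  constructor
  · refine (((hpow ((a - 1) / 2)).mul hP).const_mul (2 / s)).congr_deriv ?_
    simp only [besselV, besselU, Function.comp_apply, rpow_div_two_eq hx0 a]
    generalize besselP a (s ^ 2 * x / 4) = p at *
    generalize besselQ a (s ^ 2 * x / 4) = q at *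
    generalize x ^ ((a - 1) / 2) = z at *
    field_simp
    ring
  · refine ((hpow (a / 2)).mul hQ).congr_deriv ?_
    simp only [besselV, besselU, Function.comp_apply, rpow_div_two_eq hx0 a]
    generalize besselP a (s ^ 2 * x / 4) = p at *
    generalize besselQ a (s ^ 2 * x / 4) = q at *
    generalize besselQ' a (s ^ 2 * x / 4) = q' at *
    generalize x ^ ((a - 1) / 2) = z at *
    generalize √x = w at *
    subst hxq
    field_simp at hQ' ⊢
    linear_combination (2 * z) * hQ'

lemma sq_besselV_add_sq_besselU_pos (ha : 0 < a) {s x : ℝ} (hs : 0 < s) (hx : 0 < x) :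
    0 < besselV a s x ^ 2 + besselU a s x ^ 2 := by
  have hE := besselEnergy_pos ha (by positivity : 0 ≤ s ^ 2 * x / 4)
  have hz : 0 < x ^ ((a - 1) / 2) := Real.rpow_pos_of_pos hx _
  have hsq := Real.sq_sqrt hx.le
  have h : besselV a s x ^ 2 + besselU a s x ^ 2 = 4 / s ^ 2 * (x ^ ((a - 1) / 2)) ^ 2 *
      (besselP a (s ^ 2 * x / 4) ^ 2 + s ^ 2 * x / 4 * besselQ a (s ^ 2 * x / 4) ^ 2) := by
    rw [besselV, besselU, rpow_div_two_eq hx a, mul_pow, mul_pow, mul_pow, mul_pow, hsq]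
    field_simp
    ring
  rw [h]
  positivity

lemma continuous_besselU (ha : 0 < a) (s : ℝ) : Continuous (besselU a s) := by
  have h1 : Continuous fun x : ℝ => x ^ (a / 2) :=
    Real.continuous_rpow_const (by positivity)
  have h2 := continuous_besselQ ha
  unfold besselU
  fun_prop

lemma besselU_zero (ha : 0 < a) (s : ℝ) : besselU a s 0 = 0 := by
  rw [besselU, Real.zero_rpow (by positivity), zero_mul]

lemma besselU_one (a s : ℝ) : besselU a s 1 = besselQ a (s ^ 2 / 4) := by
  rw [besselU, Real.one_rpow, one_mul, mul_one]

/-- A square-integrable function on `(0,1)` is not asymptotic to a nonzero multiple of `x ^ (-p)` at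
`0` for `p ≥ 1/2`, because `1 / x` is not integrable there. -/
lemma eq_zero_of_tendsto_rpow_mul {v : ℝ → ℝ} {p K : ℝ} (hp : 1 / 2 ≤ p)
    (hv : MemLp v 2 (volume.restrict (Ioo (0 : ℝ) 1)))
    (hlim : Tendsto (fun x => x ^ p * v x) (𝓝[>] 0) (𝓝 K)) : K = 0 := by
  by_contra hK
  have hK' : |K| / 2 < |K| := half_lt_self (abs_pos.2 hK)
  obtain ⟨δ, hδ, hev⟩ := mem_nhdsGT_iff_exists_Ioo_subset.1
    ((hlim.abs.eventually_const_lt hK').and (Ioo_mem_nhdsGT one_pos))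
  have hδ0 : (0 : ℝ) < δ := hδ
  have hsub : Ioo 0 δ ⊆ Ioo (0 : ℝ) 1 := fun x hx => (hev hx).2
  have hint : IntegrableOn (fun x => v x ^ 2) (Ioo 0 δ) :=
    IntegrableOn.mono_set (t := Ioo 0 1) hv.integrable_sq hsub
  have hrpow : IntegrableOn (fun x : ℝ => x ^ (-1 : ℝ)) (Ioo 0 δ) := by
    refine Integrable.mono' (hint.const_mul (4 / K ^ 2)) (by fun_prop) ?_
    refine (ae_restrict_iff' measurableSet_Ioo).2 (Eventually.of_forall fun x hx => ?_)
    obtain ⟨h1, h2⟩ := hev hx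
    have hx0 : 0 < x := hx.1
    rw [Real.norm_eq_abs, abs_of_pos (Real.rpow_pos_of_pos hx0 _), Real.rpow_neg_one]
    have h3 : x ^ p ≤ √x := by
      rw [Real.sqrt_eq_rpow]
      exact Real.rpow_le_rpow_of_exponent_ge hx0 h2.2.le hp
    have h4 : |K| / 2 ≤ √x * |v x| := by
      rw [abs_mul, abs_of_pos (Real.rpow_pos_of_pos hx0 _)] at h1
      exact h1.le.trans (mul_le_mul_of_nonneg_right h3 (abs_nonneg _))
    have h5 := pow_le_pow_left₀ (by positivity) h4 2
    rw [mul_pow, Real.sq_sqrt hx0.le, div_pow, sq_abs, sq_abs] at h5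
    rw [inv_eq_one_div, div_le_iff₀ hx0, div_mul_eq_mul_div, div_mul_eq_mul_div,
      le_div_iff₀ (by positivity)]
    linarith
  rw [intervalIntegral.integrableOn_Ioo_rpow_iff hδ0] at hrpow
  exact lt_irrefl _ hrpow

/-- The left singular function vanishes at `0` and the right one is square integrable, so that the
Wronskian with the solution `besselV`, `besselU` is zero: the second solution of Bessel's equation
is excluded. -/
lemma IsBesselSingularTripleII.exists_eq_mul (ha : 0 < a) {s : ℝ} {v u : ℝ → ℝ}
    (h : IsBesselSingularTripleII (a - 1) s v u) :
    ∃ r : ℝ, ∀ x ∈ Ioo (0 : ℝ) 1, v x = r * besselV a s x ∧ u x = r * besselU a s x := by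
  have hs := h.pos
  have hsys := h.solvesBesselSystem
  have hSys := solvesBesselSystem_besselV_besselU ha hs
  refine hsys.exists_eq_mul hSys ?_ fun x hx => sq_besselV_add_sq_besselU_pos ha hs hx.1
  have h2 : (1 / 2 : ℝ) ∈ Ioo (0 : ℝ) 1 := by norm_num
  set K := √(1 / 2) * (v (1 / 2) * besselU a s (1 / 2) - besselV a s (1 / 2) * u (1 / 2)) with hK
  have hconst : ∀ x ∈ Ioo (0 : ℝ) 1, √x * (v x * besselU a s x - besselV a s x * u x) = K :=
    fun x hx => hsys.wronskian_eq hSys hx h2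
  have hmem : Ioo (0 : ℝ) 1 ∈ 𝓝[>] (0 : ℝ) := Ioo_mem_nhdsGT one_pos
  have hu : Tendsto u (𝓝[>] 0) (𝓝 0) := by
    have h1 := h.mem_domain.boundary_zero.div_const s
    rw [zero_div] at h1
    refine h1.congr' ?_
    filter_upwards [hmem] with x hx
    rw [h.action x hx, mul_div_cancel_left₀ _ hs.ne']
  have hcont : ∀ f : ℝ → ℝ, Continuous f → Tendsto f (𝓝[>] 0) (𝓝 (f 0)) := fun f hf =>
    (hf.tendsto 0).mono_left nhdsWithin_le_nhds
  have hQ := hcont (fun x => besselQ a (s ^ 2 * x / 4)) (by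
    have := continuous_besselQ ha
    fun_prop)
  have hP := hcont (fun x => x ^ (a / 2) * besselP a (s ^ 2 * x / 4)) (by
    have := continuous_besselP ha
    have : Continuous fun x : ℝ => x ^ (a / 2) := Real.continuous_rpow_const (by positivity)
    fun_prop)
  simp only [mul_zero, zero_div, besselQ_zero] at hQ hP
  have hK0 : K = 0 := by
    refine eq_zero_of_tendsto_rpow_mul (p := (a + 1) / 2) (by linarith) h.mem_domain.memLp ?_
    have h1 : Tendsto (fun x => (K + 2 / s * (x ^ (a / 2) * besselP a (s ^ 2 * x / 4)) * u x) /
        besselQ a (s ^ 2 * x / 4)) (𝓝[>] 0) (𝓝 ((K + 2 / s * _ * 0) / 1)) :=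
      (tendsto_const_nhds.add ((hP.const_mul (2 / s)).mul hu)).div hQ one_ne_zero
    rw [mul_zero, add_zero, div_one] at h1
    refine h1.congr' ?_
    filter_upwards [hmem, hQ.eventually_ne one_ne_zero] with x hx hne
    rw [div_eq_iff hne, ← hconst x hx, besselU, besselV,
      show (a + 1) / 2 = a / 2 + 1 / 2 by ring, Real.rpow_add hx.1, ← Real.sqrt_eq_rpow,
      rpow_div_two_eq hx.1 a]
    ring
  intro x hx
  have h1 := hconst x hx
  rw [hK0] at h1
  have h3 := (mul_eq_zero.1 h1).resolve_left (Real.sqrt_pos.2 hx.1).ne'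
  linarith

lemma IsBesselSingularTripleII.besselQ_eq_zero (ha : 0 < a) {s : ℝ} {v u : ℝ → ℝ}
    (h : IsBesselSingularTripleII (a - 1) s v u) : besselQ a (s ^ 2 / 4) = 0 := by
  obtain ⟨r, hr⟩ := h.exists_eq_mul ha
  obtain ⟨x, hx, hvx⟩ := h.nonzero
  have hr0 : r ≠ 0 := by
    rintro rfl
    exact hvx (by rw [(hr x hx).1, zero_mul])
  have h1 : Tendsto (fun x => s * (r * besselU a s x)) (𝓝[<] 1)
      (𝓝 (s * (r * besselU a s 1))) :=
    ((((continuous_besselU ha s).tendsto 1).mono_left nhdsWithin_le_nhds).const_mul r).const_mul s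
  have h2 : Tendsto (fun x => s * (r * besselU a s x)) (𝓝[<] 1) (𝓝 0) := by
    refine h.mem_domain.boundary_one.congr' ?_
    filter_upwards [Ioo_mem_nhdsLT one_pos] with x hx
    rw [h.action x hx, (hr x hx).2]
  have h3 := tendsto_nhds_unique h1 h2
  rw [besselU_one] at h3
  simpa [h.pos.ne', hr0] using h3

lemma isBesselSingularTripleII_of_besselQ_eq_zero (ha : 0 < a) {s : ℝ} (hs : 0 < s)
    (h0 : besselQ a (s ^ 2 / 4) = 0) :
    IsBesselSingularTripleII (a - 1) s (besselV a s) (besselU a s) := by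
  have hsys := solvesBesselSystem_besselV_besselU ha hs
  have haction : ∀ x ∈ Ioo (0 : ℝ) 1,
      besselAction (a - 1) (besselV a s) x = s * besselU a s x := by
    intro x hx
    have hq : 0 < √x := Real.sqrt_pos.2 hx.1
    have hxq : x = √x * √x := (Real.mul_self_sqrt hx.1.le).symm
    rw [besselAction, (hsys x hx).1.deriv]
    generalize besselV a s x = y at *
    generalize besselU a s x = z at *
    generalize √x = q at *
    subst hxq
    field_simp
    ring
  have hU := continuous_besselU ha s
  have hP := continuous_besselP ha
  have hae : ∀ᵐ x ∂(volume.restrict (Ioo (0 : ℝ) 1)), x ∈ Ioo (0 : ℝ) 1 :=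
    ae_restrict_mem measurableSet_Ioo
  refine ⟨hs, ⟨fun x hx => (hsys x hx).1.differentiableAt, ?_, ?_, ?_, ?_⟩, ?_,
    fun x hx => (hsys x hx).2.differentiableAt, haction, fun x hx => ?_⟩
  · have hpow : MemLp (fun x : ℝ => x ^ ((a - 1) / 2)) 2 (volume.restrict (Ioo (0 : ℝ) 1)) := by
      rw [memLp_two_iff_integrable_sq (by fun_prop)]
      have h1 : IntegrableOn (fun x : ℝ => x ^ (a - 1)) (Ioo 0 1) :=
        (intervalIntegral.integrableOn_Ioo_rpow_iff one_pos).2 (by linarith)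
      refine h1.congr ?_
      filter_upwards [hae] with x hx
      rw [← Real.rpow_natCast, ← Real.rpow_mul hx.1.le]
      congr 1
      push_cast
      ring
    obtain ⟨C, hC⟩ := isCompact_Icc.exists_bound_of_continuousOn (s := Icc (0 : ℝ) 1)
      (f := fun x => besselP a (s ^ 2 * x / 4)) (by fun_prop)
    refine (hpow.const_mul (2 / s)).of_le_mul (c := C) ?_ ?_
    · unfold besselV
      exact (((Measurable.pow_const measurable_id _).mul
        (by fun_prop : Continuous fun x => besselP a (s ^ 2 * x / 4)).measurable).const_mul
        (2 / s)).aestronglyMeasurable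
    · filter_upwards [hae] with x hx
      rw [besselV, ← mul_assoc, norm_mul, mul_comm]
      exact mul_le_mul_of_nonneg_right (hC x ⟨hx.1.le, hx.2.le⟩) (norm_nonneg _)
  · obtain ⟨C, hC⟩ := isCompact_Icc.exists_bound_of_continuousOn (s := Icc (0 : ℝ) 1)
      (f := fun x => s * besselU a s x) (by fun_prop)
    have h1 : MemLp (fun x => s * besselU a s x) 2 (volume.restrict (Ioo (0 : ℝ) 1)) := by
      refine MemLp.of_bound (by fun_prop) C ?_
      filter_upwards [hae] with x hx
      exact hC x ⟨hx.1.le, hx.2.le⟩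
    refine h1.ae_eq ?_
    filter_upwards [hae] with x hx
    exact (haction x hx).symm
  · have h1 : Tendsto (fun x => s * besselU a s x) (𝓝[>] 0) (𝓝 (s * besselU a s 0)) :=
      ((hU.const_mul s).tendsto 0).mono_left nhdsWithin_le_nhds
    rw [besselU_zero ha, mul_zero] at h1
    refine h1.congr' ?_
    filter_upwards [Ioo_mem_nhdsGT one_pos] with x hx
    exact (haction x hx).symm
  · have h1 : Tendsto (fun x => s * besselU a s x) (𝓝[<] 1) (𝓝 (s * besselU a s 1)) :=
      ((hU.const_mul s).tendsto 1).mono_left nhdsWithin_le_nhds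
    rw [besselU_one, h0, mul_zero] at h1
    refine h1.congr' ?_
    filter_upwards [Ioo_mem_nhdsLT one_pos] with x hx
    exact (haction x hx).symm
  · have h1 : Tendsto (fun x => besselP a (s ^ 2 * x / 4)) (𝓝[>] 0) (𝓝 (besselP a 0)) := by
      have : Continuous fun x => besselP a (s ^ 2 * x / 4) := by fun_prop
      simpa using (this.tendsto 0).mono_left nhdsWithin_le_nhds
    obtain ⟨x, hx, hx'⟩ := ((h1.eventually_ne (by rw [besselP_zero]; exact ha.ne')).and
      (Ioo_mem_nhdsGT one_pos)).exists
    exact ⟨x, hx', mul_ne_zero (by positivity)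
      (mul_ne_zero (Real.rpow_pos_of_pos hx'.1 _).ne' hx)⟩
  · have hq : 0 < √x := Real.sqrt_pos.2 hx.1
    have hxq : x = √x * √x := (Real.mul_self_sqrt hx.1.le).symm
    rw [besselAdjointAction, (hsys x hx).2.deriv]
    generalize besselV a s x = y at *
    generalize besselU a s x = z at *
    generalize √x = q at *
    subst hxq
    field_simp
    ring

/-- The positive singular values are the numbers `2 √t`, where `t` runs through the positive zeros
of `Q`. -/
theorem listsBesselSingularValuesII (ha : 0 < a) {τ : ℕ → ℝ} (hτ : StrictMono τ) (hτ0 : τ 0 = 0)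
    (hrange : Set.range τ = {t | 0 ≤ t ∧ t * besselQ a t = 0}) :
    ListsBesselSingularValuesII (a - 1) fun k => 2 * √(τ (k + 1)) := by
  have hpos : ∀ k, 0 < τ (k + 1) := fun k => hτ0 ▸ hτ k.succ_pos
  refine ⟨fun i j hij => ?_, ?_, ?_⟩
  · exact mul_lt_mul_of_pos_left (Real.sqrt_lt_sqrt (hpos i).le (hτ (Nat.succ_lt_succ hij))) two_pos
  · ext s
    constructor
    · rintro ⟨k, rfl⟩
      have h : τ (k + 1) ∈ {t | 0 ≤ t ∧ t * besselQ a t = 0} := hrange ▸ mem_range_self _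
      refine ⟨_, _, isBesselSingularTripleII_of_besselQ_eq_zero ha
        (mul_pos two_pos (Real.sqrt_pos.2 (hpos k))) ?_⟩
      rw [mul_pow, Real.sq_sqrt (hpos k).le, show (2 : ℝ) ^ 2 * τ (k + 1) / 4 = τ (k + 1) by ring]
      exact (mul_eq_zero.1 h.2).resolve_left (hpos k).ne'
    · rintro ⟨v, u, h⟩
      have h1 : s ^ 2 / 4 ∈ Set.range τ := by
        rw [hrange]
        exact ⟨by positivity, by rw [h.besselQ_eq_zero ha, mul_zero]⟩
      obtain ⟨k, hk⟩ := h1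
      have hs := h.pos
      cases k with
      | zero =>
        rw [hτ0] at hk
        have : 0 < s ^ 2 / 4 := by positivity
        exact absurd hk this.ne
      | succ k =>
        refine ⟨k, ?_⟩
        change 2 * √(τ (k + 1)) = s
        rw [hk, show s ^ 2 / 4 = (s / 2) ^ 2 by ring, Real.sqrt_sq (by positivity)]
        ring
  · intro s v u v' u' h h'
    obtain ⟨r, hr⟩ := h.exists_eq_mul ha
    obtain ⟨r', hr'⟩ := h'.exists_eq_mul ha
    obtain ⟨x, hx, hvx⟩ := h.nonzero
    have hr0 : r ≠ 0 := by
      rintro rfl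
      exact hvx (by rw [(hr x hx).1, zero_mul])
    refine ⟨r' / r, fun x hx => ?_⟩
    rw [(hr x hx).1, (hr' x hx).1]
    field_simp

/-! ### The discretization error -/

/-- A bound for the remainder of the first-order Taylor expansion of the square root that holds for
every admissible increment: with `p = √x` and `q = √(x + δ)` the remainder is
`-(q - p)² / (2 p)`, and `δ = (q - p) (q + p)` with `q + p ≥ p`. -/
lemma abs_sqrt_add_sub_le {x δ : ℝ} (hx : 0 < x) (hxδ : 0 ≤ x + δ) :
    |√(x + δ) - √x - δ / (2 * √x)| ≤ δ ^ 2 / (2 * √x ^ 3) := by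
  have hp : 0 < √x := Real.sqrt_pos.2 hx
  have hq : 0 ≤ √(x + δ) := Real.sqrt_nonneg _
  have hδ : δ = √(x + δ) ^ 2 - √x ^ 2 := by
    rw [Real.sq_sqrt hx.le, Real.sq_sqrt hxδ]; ring
  generalize √x = p at *
  generalize √(x + δ) = q at *
  have h1 : q - p - δ / (2 * p) = -((q - p) ^ 2 / (2 * p)) := by
    rw [hδ]; field_simp; ring
  have h2 : δ ^ 2 / (2 * p ^ 3) = (q - p) ^ 2 / (2 * p) * ((q + p) / p) ^ 2 := by
    rw [hδ]; field_simp; ring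
  rw [h1, h2, abs_neg, abs_of_nonneg (by positivity)]
  refine le_mul_of_one_le_right (by positivity) (one_le_pow₀ ?_)
  rw [one_le_div hp]
  linarith

lemma sqrt_two_div_mul_sqrt {h y : ℝ} (hh : 0 < h) (hy : 0 ≤ y) :
    √(2 / h) * √y = √(h * (2 * y)) / h := by
  rw [← Real.sqrt_mul (by positivity), show 2 / h * y = h * (2 * y) / h ^ 2 by field_simp,
    Real.sqrt_div (by positivity), Real.sqrt_sq hh.le]

/-- With `x` the mesh point of the row, the entries of `h M_hard` are `√(x + h (a - 1))` and
`-√(x - h (a - 1))`, and those of `h` times the discretization are their first-order Taylor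
expansions at `x`. -/
lemma abs_laguerreRectHard_sub_besselDiscretization_le (ha : 0 < a) (n : ℕ) (i : Fin n)
    (j : Fin (n + 1)) :
    |laguerreRectHard a n i j - besselDiscretization a n i j| ≤
      (a - 1) ^ 2 / (2 * √(hardMeshPoint a n (2 * (i + 1))) ^ 3) * hardMeshSize a n := by
  have hh := hardMeshSize_pos ha n
  have hx : hardMeshPoint a n (2 * (i + 1)) = hardMeshSize a n * (a + 1 + 2 * (i : ℕ)) := by
    rw [hardMeshPoint]; push_cast; ring
  have hx0 : 0 < hardMeshPoint a n (2 * (i + 1)) := by rw [hx]; positivity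
  rw [laguerreRectHard_apply, besselDiscretization_apply]
  have e1 : hardMeshSize a n * (2 * (a + (i : ℕ))) =
      hardMeshPoint a n (2 * (i + 1)) + hardMeshSize a n * (a - 1) := by rw [hx]; ring
  have e2 : hardMeshSize a n * (2 * ((i : ℕ) + 1)) =
      hardMeshPoint a n (2 * (i + 1)) + -(hardMeshSize a n * (a - 1)) := by rw [hx]; ring
  have hrhs : ∀ δ : ℝ, δ ^ 2 = (hardMeshSize a n * (a - 1)) ^ 2 →
      δ ^ 2 / (2 * √(hardMeshPoint a n (2 * (i + 1))) ^ 3) =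
      (a - 1) ^ 2 / (2 * √(hardMeshPoint a n (2 * (i + 1))) ^ 3) * hardMeshSize a n *
        hardMeshSize a n := by
    intro δ hδ
    rw [hδ]; ring
  have hsq : √(hardMeshPoint a n (2 * (i + 1))) ≠ 0 := (Real.sqrt_pos.2 hx0).ne'
  split_ifs with h1 h2
  · have hb := abs_sqrt_add_sub_le hx0 (δ := hardMeshSize a n * (a - 1))
      (by rw [← e1]; positivity)
    rw [hrhs _ rfl, ← div_le_iff₀ hh, ← abs_of_pos hh, ← abs_div, abs_of_pos hh] at hb
    rw [sqrt_two_div_mul_sqrt hh (by positivity), e1]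
    refine (congrArg abs ?_).trans_le hb
    field_simp
    ring
  · have hb := abs_sqrt_add_sub_le hx0 (δ := -(hardMeshSize a n * (a - 1)))
      (by rw [← e2]; positivity)
    rw [hrhs _ (neg_sq _), ← div_le_iff₀ hh, ← abs_of_pos hh, ← abs_div, abs_of_pos hh] at hb
    rw [mul_neg, sqrt_two_div_mul_sqrt hh (by positivity), e2]
    refine (abs_neg _).symm.trans_le ((congrArg abs ?_).trans_le hb)
    field_simp
    ring
  · rw [mul_zero, sub_zero, abs_zero]
    positivity

end

theorem mainTheorem4 (a : ℝ) (ha : 0 < a) :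
    (∃ E : (n : ℕ) → Matrix (Fin n) (Fin (n + 1)) ℝ,
      (∀ n, laguerreRectHard a n = besselDiscretization a n + E n) ∧
      (∀ n, IsUpperBidiagonal (E n)) ∧
      (∀ ε : ℝ, 0 < ε → ∃ C : ℝ, ∀ (n : ℕ) (i : Fin n) (j : Fin (n + 1)),
        ⌈ε / hardMeshSize a n⌉₊ ≤ (i : ℕ) + 1 → |E n i j| ≤ C * hardMeshSize a n)) ∧
    (∃ σ : ℕ → ℝ, ListsBesselSingularValuesII (a - 1) σ ∧
      ∀ k : ℕ, Tendsto (fun n : ℕ => kthLeastSingularValue (laguerreRectHard a n) (k + 1))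
        atTop (𝓝 (σ k))) := by
  refine ⟨⟨fun n => laguerreRectHard a n - besselDiscretization a n,
    fun n => (add_sub_cancel _ _).symm, fun n i j h1 h2 => ?_, fun ε hε =>
      ⟨(a - 1) ^ 2 / (2 * √ε ^ 3), fun n i j hij => ?_⟩⟩, ?_⟩
  · change laguerreRectHard a n i j - besselDiscretization a n i j = 0
    rw [laguerreRectHard_apply, besselDiscretization_apply]
    simp [h1, h2]
  · have hh := hardMeshSize_pos ha n
    refine (abs_laguerreRectHard_sub_besselDiscretization_le ha n i j).trans ?_
    -- the mesh point `h (a + 1 + 2 i)` exceeds `h (i + 1) ≥ ε`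
    have hε' : ε ≤ hardMeshPoint a n (2 * (i + 1)) := by
      have h1 := (Nat.le_ceil _).trans (Nat.cast_le (α := ℝ).2 hij)
      rw [div_le_iff₀ hh] at h1
      push_cast at h1
      refine h1.trans ?_
      rw [hardMeshPoint, mul_comm]
      push_cast
      refine mul_le_mul_of_nonneg_left ?_ hh.le
      linarith [(i : ℕ).cast_nonneg (α := ℝ)]
    have hs : 0 < √ε := Real.sqrt_pos.2 hε
    gcongr
  · obtain ⟨τ, hτ, hτ0, hrange⟩ := exists_besselZeros ha
    exact ⟨_, listsBesselSingularValuesII ha hτ hτ0 hrange,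
      tendsto_kthLeastSingularValue ha hτ hτ0 hrange⟩
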